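/- Let $A\in\mathbb{R}^{n\times m}$ have rank $r\ge 1$ and thin singular value decomposition $A=U\Sigma V^\top$, where $U\in\mathbb{R}^{n\times r}$ and $V\in\mathbb{R}^{m\times r}$ have orthonormal columns and $\Sigma=\operatorname{diag}(\sigma_1,\dots,\sigma_r)$ with $\sigma_1\ge\dots\ge\sigma_r>0$; put $\kappa=\sigma_1/\sigma_r$. Write $\|\cdot\|$ for the spectral norm, $\|\cdot\|_F$ for the Frobenius norm and $\|M\|_{2,\infty}=\max_i\|M_{i,\cdot}\|_2$ for the largest Euclidean norm of a row. Suppose that $A$ is $(\mu_1,\mu_2)$-incoherent, i.e. $\|U\|_{2,\infty}^2\le \mu_1 r/n$ and $\|V\|_{2,\infty}^2\le\mu_2 r/m$. Wedge sampling with rate $p\in(0,1]$: every triple $(i,\ell,j)$ with $1\le i\le j\le n$ and $1\le\ell\le m$ is put into a random set $\tilde{\mathcal W}$ independently with probability $p$. Put $Z_{i\ell j}=p^{-1}A_{i\ell}A_{j\ell}\mathbf 1_{(i,\ell,j)\in\tilde{\mathcal W}}\,e_ie_j^\top$ and $$Z=\sum_{i<j,\ \ell}\bigl(Z_{i\ell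 j}+Z_{i\ell j}^\top\bigr)+\sum_{i,\ell}Z_{i\ell i}.$$ Let $\hat U\in\mathbb{R}^{n\times r}$ have as columns $r$ orthonormal eigenvectors of $Z$ belonging to its $r$ highest eigenvalues (taken from an orthonormal eigenbasis, with multiplicity), and let $R$ be a minimizer of $\|\hat U O-U\|_F$ over the orthogonal matrices $O\in\mathbb{R}^{r\times r}$. For a real number $a>0$ put $$\eta=\sqrt{\frac{\kappa^4 a\,\mu_1\mu_2 r^2\log n}{mnp}}.$$ Theorem (left singular subspace recovery). For every $a_0>0$ there are constants $c_0,C,K>0$, depending only on $a_0$, such that for all $n,m,r,A,\mu_1,\mu_2$ as above, all $a\ge a_0$ and all $p\in(0,1]$ with $$p\ \ge\ \frac{c_0\,\kappa^4 a\,\mu_1\mu_2 r^2\log n}{mn},$$ with probability at least $1-K n^{-a}$, for every choice of $\hat U$ and $R$ as above, $$\|\hat U R-U\|\le C\eta\qquad\text{and}\qquad \|\hat U R-U\|_{2,\infty}\le C\eta\,\|U\|_{2,\infty}.$$ In particular, for $a\ge 1$ all the constants are absolute, and for each fixed $a>0$ they depend on $a$ only. -/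

import Mathlib

open MeasureTheory ProbabilityTheory
open scoped Matrix

-- With this scope open, `‖M‖` for a matrix `M` is the spectral norm
-- (the operator norm between Euclidean spaces).
open scoped Matrix.Norms.L2Operator

noncomputable section

namespace WedgeSampling

/-- Thin singular value decomposition `M = U Σ Vᵀ`: the columns of `U` and of `V` are orthonormal
and `Σ = diag σ` has positive entries in decreasing order, so that `r` is the rank of `M`. -/
structure IsThinSVD {n m r : ℕ} (M : Matrix (Fin n) (Fin m) ℝ)
    (U : Matrix (Fin n) (Fin r) ℝ) (σ : Fin r → ℝ) (V : Matrix (Fin m) (Fin r) ℝ) : Prop where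
  left_orthonormal : Uᵀ * U = 1
  right_orthonormal : Vᵀ * V = 1
  pos : ∀ k, 0 < σ k
  antitone : Antitone σ
  eq_mul : M = U * Matrix.diagonal σ * Vᵀ

/-- The condition number `κ = σ₁ / σ_r`. -/
def condNumber {r : ℕ} (hr : 0 < r) (σ : Fin r → ℝ) : ℝ :=
  σ ⟨0, hr⟩ / σ ⟨r - 1, Nat.sub_lt hr Nat.one_pos⟩

/-- The norm `‖M‖_{2,∞}`: the largest Euclidean norm of a row of `M`. -/
def twoInfNorm {n r : ℕ} (M : Matrix (Fin n) (Fin r) ℝ) : ℝ :=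
  ⨆ i, Real.sqrt (∑ k, M i k ^ 2)

/-- The Frobenius norm. -/
def frobNorm {n r : ℕ} (M : Matrix (Fin n) (Fin r) ℝ) : ℝ :=
  Real.sqrt (∑ i, ∑ k, M i k ^ 2)

/-- `M` is `(μ₁, μ₂)`-incoherent. The row norms of `U` and `V` are the same for all thin singular
value decompositions of `M`, so the quantifier over them makes no choice. -/
def IsIncoherent {n m : ℕ} (M : Matrix (Fin n) (Fin m) ℝ) (μ₁ μ₂ : ℝ) : Prop :=
  ∀ (r : ℕ) (U : Matrix (Fin n) (Fin r) ℝ) (σ : Fin r → ℝ) (V : Matrix (Fin m) (Fin r) ℝ),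
    IsThinSVD M U σ V →
      twoInfNorm U ^ 2 ≤ μ₁ * r / n ∧ twoInfNorm V ^ 2 ≤ μ₂ * r / m

/-- The set of wedges `(i, ℓ, j)` with `i ≤ j`. -/
abbrev Wedge (n m : ℕ) : Type := {w : Fin n × Fin m × Fin n // w.1 ≤ w.2.2}

open Classical in
/-- The matrix `Z_{iℓj} = p⁻¹ A_{iℓ} A_{jℓ} 1[(i,ℓ,j) ∈ W] e_i e_jᵀ`. -/
def wedgeTerm {n m : ℕ} (A : Matrix (Fin n) (Fin m) ℝ) (p : ℝ) (W : Set (Wedge n m))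
    (w : Wedge n m) : Matrix (Fin n) (Fin n) ℝ :=
  Matrix.single w.1.1 w.1.2.2
    (p⁻¹ * A w.1.1 w.1.2.1 * A w.1.2.2 w.1.2.1 * (if w ∈ W then 1 else 0))

/-- The wedge matrix `Z = ∑_{i<j, ℓ} (Z_{iℓj} + Z_{iℓj}ᵀ) + ∑_{i, ℓ} Z_{iℓi}` built from the
matrix `A`, the sampling rate `p` and the set `W` of sampled wedges. -/
def wedgeMatrix {n m : ℕ} (A : Matrix (Fin n) (Fin m) ℝ) (p : ℝ) (W : Set (Wedge n m)) :
    Matrix (Fin n) (Fin n) ℝ :=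
  (∑ w : Wedge n m with w.1.1 < w.1.2.2, (wedgeTerm A p W w + (wedgeTerm A p W w)ᵀ)) +
    ∑ w : Wedge n m with w.1.1 = w.1.2.2, wedgeTerm A p W w

/-- `Uhat` consists of `r` columns of the orthogonal matrix `Q` of an eigendecomposition
`Z = Q diag(d) Qᵀ`, the selected eigenvalues being the `r` highest ones (with multiplicity). -/
def IsTopEigenvectors {n r : ℕ} (Z : Matrix (Fin n) (Fin n) ℝ)
    (Uhat : Matrix (Fin n) (Fin r) ℝ) : Prop :=
  ∃ (Q : Matrix (Fin n) (Fin n) ℝ) (d : Fin n → ℝ) (f : Fin r ↪ Fin n),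
    Qᵀ * Q = 1 ∧ Z = Q * Matrix.diagonal d * Qᵀ ∧
    (∀ k l, l ∉ Set.range f → d l ≤ d (f k)) ∧
    Uhat = Q.submatrix id f

/-- `R` minimizes `‖Uhat O - U‖_F` over the orthogonal `r × r` matrices `O`. -/
def IsProcrustes {n r : ℕ} (Uhat U : Matrix (Fin n) (Fin r) ℝ)
    (R : Matrix (Fin r) (Fin r) ℝ) : Prop :=
  Rᵀ * R = 1 ∧
    ∀ O : Matrix (Fin r) (Fin r) ℝ, Oᵀ * O = 1 → frobNorm (Uhat * R - U) ≤ frobNorm (Uhat * O - U)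

/-- Each wedge `w` is sampled independently with probability `p`; `sampled w` is the event that
`w` is sampled. -/
structure IsWedgeSampling {n m : ℕ} {Ω : Type*} [MeasurableSpace Ω] (P : Measure Ω) (p : ℝ)
    (sampled : Wedge n m → Set Ω) : Prop where
  measurableSet : ∀ w, MeasurableSet (sampled w)
  indep : iIndepSet sampled P
  prob : ∀ w, P (sampled w) = ENNReal.ofReal p

/-- The error rate `η = sqrt (κ⁴ a μ₁ μ₂ r² log n / (m n p))`. -/
def errorRate (n m r : ℕ) (κ μ₁ μ₂ a p : ℝ) : ℝ :=
  Real.sqrt (κ ^ 4 * a * μ₁ * μ₂ * (r : ℝ) ^ 2 * Real.log n / (m * n * p))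

end WedgeSampling

end

/-! Write `Z = A * Aᵀ + X`, where `X` is a sum over wedges of independent centered coins times fixed
symmetric matrices. The signal `A * Aᵀ = U Σ² Uᵀ` has smallest nonzero eigenvalue `s = σ_r²`, so
everything follows from `‖X‖ ≤ ε s` and a row-wise analogue, with `ε` a constant multiple of `η`.

Concentration comes from high moments. The exchangeable-pairs inequality `bernE_coin_mul_le` and a
mean value inequality for traces bound `E tr X^{2q}` by the conditional variance of `X`. The matrix
of a single wedge has a diagonal square, so this variance is diagonal and only scalar moments remain
(`bernE_trace_pow_le`). Incoherence bounds the total variance of a row by `σ₁⁴ β / p` up to a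
constant, where `β = μ₁ μ₂ r² / (m n)`. With `q` about `(a + 1) log n`, Markov's inequality makes
the failure probability at most `n e^{-q} ≤ n^{-a}`.

The deterministic part replaces `Uhat` by the basis `Y` of the same subspace with `Uᵀ Y = 1`. It
involves no rotation and solves the quadratic equation `(Y - U) Σ² = X Y - Y Uᵀ X Y`
(`IsInvariantGraph`). Davis-Kahan gives `‖Y - U‖ ≤ 4 ε`, and solutions for two perturbations satisfy
`s ‖Y - Y'‖ ≤ 3 ‖(X - X') Y'‖`. For the `k`-th row, let `Y'` belong to `X` with row and column `k`
deleted. Then `Y'` is independent of row `k` of `X`, so a vector concentration bound, conditional on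
the other wedges, controls row `k` of `X Y'`. The Lipschitz estimate carries this over to `Y`
(`IsInvariantGraph.twoInfNorm_sub_le`).

Finally, Procrustes optimality forces `Uᵀ Uhat R` to be symmetric and positive semidefinite, so it
differs from the identity by at most `‖Y - U‖²`. The alignment therefore costs only a second-order
term (`IsInvariantGraph.aligned_sub_eq`). -/

noncomputable section

namespace WedgeSampling

/-! ### Finite product Bernoulli measures and the exchangeable-pairs inequality -/

section Bernoulli

set_option linter.unusedSectionVars false

variable {ι : Type*} [Fintype ι] [DecidableEq ι]

/-- The probability of the outcome `b` of independent coin tosses with success probability `p`. -/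
def bernWeight (p : ℝ) (b : ι → Bool) : ℝ := ∏ i, if b i then p else 1 - p

/-- The expectation of `f` under independent coin tosses with success probability `p`. -/
def bernE (p : ℝ) (f : (ι → Bool) → ℝ) : ℝ := ∑ b, bernWeight p b * f b

lemma bernWeight_nonneg {p : ℝ} (hp : 0 ≤ p) (hp1 : p ≤ 1) (b : ι → Bool) :
    0 ≤ bernWeight p b :=
  Finset.prod_nonneg fun i _ => by split_ifs <;> linarith

lemma bernE_prod (p : ℝ) (g : ι → Bool → ℝ) :
    bernE p (fun b => ∏ i, g i (b i)) = ∏ i, (p * g i true + (1 - p) * g i false) := by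
  have h := Finset.prod_univ_sum (fun _ : ι => (Finset.univ : Finset Bool))
    (fun i c => (if c then p else 1 - p) * g i c)
  simp only [Fintype.piFinset_univ] at h
  simp only [bernE, bernWeight, ← Finset.prod_mul_distrib]
  rw [← h]
  simp

lemma bernE_const (p c : ℝ) : bernE (ι := ι) p (fun _ => c) = c := by
  have h := bernE_prod (ι := ι) p (fun _ _ => 1)
  simp only [Finset.prod_const_one, mul_one, add_sub_cancel] at h
  simp only [bernE, mul_one] at h ⊢
  rw [← Finset.sum_mul, h, one_mul]

lemma bernE_mono {p : ℝ} (hp : 0 ≤ p) (hp1 : p ≤ 1) {f g : (ι → Bool) → ℝ}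
    (h : ∀ b, f b ≤ g b) : bernE p f ≤ bernE p g :=
  Finset.sum_le_sum fun b _ => mul_le_mul_of_nonneg_left (h b) (bernWeight_nonneg hp hp1 b)

lemma bernE_add (p : ℝ) (f g : (ι → Bool) → ℝ) :
    bernE p (fun b => f b + g b) = bernE p f + bernE p g := by
  simp [bernE, mul_add, Finset.sum_add_distrib]

lemma bernE_const_mul (p c : ℝ) (f : (ι → Bool) → ℝ) :
    bernE p (fun b => c * f b) = c * bernE p f := by
  simp only [bernE, Finset.mul_sum]
  exact Finset.sum_congr rfl fun b _ => by ring

lemma bernE_sum {κ : Type*} (s : Finset κ) (p : ℝ) (f : κ → (ι → Bool) → ℝ) :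
    bernE p (fun b => ∑ k ∈ s, f k b) = ∑ k ∈ s, bernE p (f k) := by
  simp only [bernE, Finset.mul_sum]
  exact Finset.sum_comm

lemma bernWeight_piecewise_mul (p : ℝ) (S : Finset ι) (b b' : ι → Bool) :
    bernWeight p (S.piecewise b' b) * bernWeight p (S.piecewise b b') =
      bernWeight p b * bernWeight p b' := by
  simp only [bernWeight, ← Finset.prod_mul_distrib]
  refine Finset.prod_congr rfl fun i _ => ?_
  by_cases hi : i ∈ S <;> simp [hi, mul_comm]

/-- Resampling the coordinates in `S` does not change the expectation. -/
lemma bernE_resample (p : ℝ) (S : Finset ι) (f : (ι → Bool) → ℝ) :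
    bernE p (fun b => bernE p (fun b' => f (S.piecewise b' b))) = bernE p f := by
  have h1 : bernE p f = bernE p (fun b => bernE (ι := ι) p (fun _ => f b)) := by
    simp only [bernE_const]
  rw [h1]
  simp only [bernE, Finset.mul_sum, ← Finset.sum_product', Finset.univ_product_univ]
  -- Swapping the `S`-coordinates of two independent outcomes is an involution that preserves the
  -- product weight.
  have hinv : Function.Involutive
      (fun x : (ι → Bool) × (ι → Bool) => (S.piecewise x.2 x.1, S.piecewise x.1 x.2)) := by
    intro x
    ext i <;> by_cases hi : i ∈ S <;> simp [hi]
  refine Fintype.sum_equiv hinv.toPerm _ _ fun x => ?_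
  have := bernWeight_piecewise_mul p S x.1 x.2
  simp only [Function.Involutive.coe_toPerm]
  rw [← mul_assoc, ← mul_assoc, this]

lemma bernE_coord (p : ℝ) (w : ι) (g : Bool → ℝ) :
    bernE p (fun b : ι → Bool => g (b w)) = p * g true + (1 - p) * g false := by
  have h := bernE_prod p (fun i c => if i = w then g c else 1)
  simp only [Finset.prod_ite_eq', Finset.mem_univ, if_true] at h
  rw [h, Finset.prod_eq_single w]
  · simp
  · intro i _ hi
    simp [hi]
  · simp

lemma bernE_update (p : ℝ) (w : ι) (f : (ι → Bool) → ℝ) :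
    bernE p f = bernE p (fun b =>
      p * f (Function.update b w true) + (1 - p) * f (Function.update b w false)) := by
  rw [← bernE_resample p {w} f]
  congr 1
  ext b
  rw [← bernE_coord p w (fun c => f (Function.update b w c))]
  congr 1
  ext b'
  rw [Finset.piecewise_singleton]

/-- The centered and normalized coin `1[success] / p - 1`. -/
def coin (p : ℝ) (c : Bool) : ℝ := (if c then p⁻¹ else 0) - 1

/-- The square of the coin plus its variance. -/
def coinSq (p : ℝ) (c : Bool) : ℝ := coin p c ^ 2 + (1 - p) / p

/-- Together with `coinSq_false`: weighting the two values by `p` and `1 - p` gives `(1 - p) / p` in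
both cases. This balance makes the exchangeable-pairs bound symmetric in the two values of the coin.
-/
lemma coinSq_true {p : ℝ} (hp : 0 < p) : coinSq p true = (1 - p) / p ^ 2 := by
  simp only [coinSq, coin, if_true]
  field_simp
  ring

lemma coinSq_false {p : ℝ} (hp : 0 < p) : coinSq p false = 1 / p := by
  simp only [coinSq, coin]
  simp
  field_simp
  ring

lemma coinSq_nonneg {p : ℝ} (hp : 0 < p) (hp1 : p ≤ 1) (c : Bool) : 0 ≤ coinSq p c := by
  have : 0 ≤ (1 - p) / p := div_nonneg (by linarith) hp.le
  unfold coinSq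
  positivity

lemma coinSq_le {p : ℝ} (hp : 0 < p) (hp1 : p ≤ 1) (c : Bool) : coinSq p c ≤ 1 / p ^ 2 := by
  cases c
  · rw [coinSq_false hp]
    exact one_div_le_one_div_of_le (by positivity) (by nlinarith)
  · rw [coinSq_true hp]
    gcongr
    linarith

/-- Exchangeable-pairs inequality for one coordinate. -/
lemma bernE_coin_mul_le {p : ℝ} (hp : 0 < p) (hp1 : p ≤ 1) (w : ι) (c : ℝ)
    (φ h : (ι → Bool) → ℝ)
    (hφ : ∀ b, φ (Function.update b w true) - φ (Function.update b w false) ≤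
      c * p⁻¹ * (h (Function.update b w true) + h (Function.update b w false))) :
    bernE p (fun b => coin p (b w) * φ b) ≤ c * bernE p (fun b => coinSq p (b w) * h b) := by
  rw [bernE_update p w, bernE_update p w (fun b => coinSq p (b w) * h b), ← bernE_const_mul]
  refine bernE_mono hp.le hp1 fun b => ?_
  -- With the other coordinates fixed, the left side is `1 - p` times the increment of `φ`, and the
  -- right side is `c (1 - p) / p` times the sum of the two values of `h`.
  have h1 := mul_le_mul_of_nonneg_left (hφ b) (sub_nonneg.2 hp1)
  simp only [Function.update_self]
  rw [coinSq_true hp, coinSq_false hp]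
  have e1 : coin p true = p⁻¹ - 1 := by simp [coin]
  have e2 : coin p false = -1 := by simp [coin]
  rw [e1, e2]
  have hp' : p * p⁻¹ = 1 := mul_inv_cancel₀ hp.ne'
  calc _ = (1 - p) * (φ (Function.update b w true) - φ (Function.update b w false)) := by
        linear_combination (φ (Function.update b w true)) * hp'
    _ ≤ _ := h1
    _ = _ := by field_simp

/-- The expectation factorizes. Since `coinSq` is at most `1 / p²`, each exponent lies in `[0, 1]`,
where `exp x ≤ 1 + x + x² ≤ 1 + 2 x`; the mean of `coinSq` is `2 (1 - p) / p`. -/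
lemma bernE_exp_coinSq_le {p : ℝ} (hp : 0 < p) (hp1 : p ≤ 1) {θ : ℝ} (hθ : 0 ≤ θ)
    (c : ι → ℝ) (hc : ∀ w, 0 ≤ c w) (hθc : ∀ w, θ * c w ≤ p ^ 2) :
    bernE p (fun b => Real.exp (θ * ∑ w, coinSq p (b w) * c w)) ≤
      Real.exp (4 * θ / p * ∑ w, c w) := by
  have h1 : (fun b : ι → Bool => Real.exp (θ * ∑ w, coinSq p (b w) * c w)) =
      fun b => ∏ w, (fun w c' => Real.exp (θ * (coinSq p c' * c w))) w (b w) := by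
    ext b
    rw [Finset.mul_sum, Real.exp_sum]
  rw [h1, Finset.mul_sum, Real.exp_sum]
  refine (bernE_prod p (fun w c' => Real.exp (θ * (coinSq p c' * c w)))).trans_le ?_
  refine Finset.prod_le_prod (fun w _ => ?_) fun w _ => ?_
  · have : 0 ≤ 1 - p := by linarith
    positivity
  · have key : ∀ c', Real.exp (θ * (coinSq p c' * c w)) ≤ 1 + 2 * (θ * (coinSq p c' * c w)) := by
      intro c'
      have h0 : 0 ≤ θ * (coinSq p c' * c w) :=
        mul_nonneg hθ (mul_nonneg (coinSq_nonneg hp hp1 c') (hc w))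
      have h1 : θ * (coinSq p c' * c w) ≤ 1 := by
        calc θ * (coinSq p c' * c w) = coinSq p c' * (θ * c w) := by ring
          _ ≤ 1 / p ^ 2 * p ^ 2 := mul_le_mul (coinSq_le hp hp1 c') (hθc w)
              (mul_nonneg hθ (hc w)) (by positivity)
          _ = 1 := by field_simp
      have := Real.abs_exp_sub_one_sub_id_le (abs_le.2 ⟨by linarith, h1⟩)
      have := (abs_le.1 this).2
      nlinarith
    have hq : 0 ≤ 1 - p := by linarith
    have hθw : 0 ≤ θ * c w := mul_nonneg hθ (hc w)
    calc p * Real.exp (θ * (coinSq p true * c w)) + (1 - p) * Real.exp (θ * (coinSq p false * c w))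
        ≤ p * (1 + 2 * (θ * (coinSq p true * c w))) +
          (1 - p) * (1 + 2 * (θ * (coinSq p false * c w))) := by
            gcongr <;> exact key _
      _ = 1 + 4 * (1 - p) / p * (θ * c w) := by
            rw [coinSq_true hp, coinSq_false hp]
            field_simp
            ring
      _ ≤ 1 + 4 * θ / p * c w := by
            have : 4 * (1 - p) / p * (θ * c w) ≤ 4 / p * (θ * c w) := by
              gcongr
              linarith
            have e : 4 * θ / p * c w = 4 / p * (θ * c w) := by ring
            linarith
      _ ≤ _ := by
            have := Real.add_one_le_exp (4 * θ / p * c w)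
            linarith

/-- Moments of sums of independent nonnegative variables. -/
lemma bernE_sum_coinSq_pow_le {p : ℝ} (hp : 0 < p) (hp1 : p ≤ 1) {q : ℕ} (hq : 0 < q)
    {B : ℝ} (hB : 0 < B) (c : ι → ℝ) (hc : ∀ w, 0 ≤ c w) (hcB : ∑ w, c w ≤ B)
    (hqc : ∀ w, q * c w ≤ p * B) :
    bernE p (fun b => (∑ w, coinSq p (b w) * c w) ^ q) ≤ (Real.exp 4 * B / p) ^ q := by
  have hq' : (0 : ℝ) < q := by exact_mod_cast hq
  -- This `θ` turns `x ≤ exp x` at `x = D p / B`, raised to the power `q`, into `D ^ q ≤ (B / p) ^ q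
  -- * exp (θ D)`.
  set θ : ℝ := q * p / B with hθ
  have hθ0 : 0 < θ := by positivity
  have h1 := bernE_exp_coinSq_le hp hp1 hθ0.le c hc (fun w => by
    rw [hθ, div_mul_eq_mul_div, div_le_iff₀ hB]
    nlinarith [hqc w])
  calc bernE p (fun b => (∑ w, coinSq p (b w) * c w) ^ q)
      ≤ bernE p (fun b => (B / p) ^ q * Real.exp (θ * ∑ w, coinSq p (b w) * c w)) := by
        refine bernE_mono hp.le hp1 fun b => ?_
        set D := ∑ w, coinSq p (b w) * c w
        have hD : 0 ≤ D := Finset.sum_nonneg fun w _ => mul_nonneg (coinSq_nonneg hp hp1 _) (hc w)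
        have h2 : D * (p / B) ≤ Real.exp (D * (p / B)) := by
          have := Real.add_one_le_exp (D * (p / B))
          linarith
        calc D ^ q = (B / p) ^ q * (D * (p / B)) ^ q := by
              rw [← mul_pow]; congr 1; field_simp
          _ ≤ (B / p) ^ q * (Real.exp (D * (p / B))) ^ q := by gcongr
          _ = _ := by
              rw [← Real.exp_nat_mul]; congr 2; rw [hθ]; ring
    _ ≤ (B / p) ^ q * Real.exp (4 * θ / p * ∑ w, c w) := by
        rw [bernE_const_mul]
        gcongr
    _ ≤ (B / p) ^ q * Real.exp (q * 4) := by
        refine mul_le_mul_of_nonneg_left (Real.exp_le_exp.2 ?_) (by positivity)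
        calc 4 * θ / p * ∑ w, c w ≤ 4 * θ / p * B := by gcongr
          _ = q * 4 := by rw [hθ]; field_simp
    _ = _ := by
        rw [Real.exp_nat_mul, ← mul_pow]; congr 1; ring

end Bernoulli

/-! ### Scalar mean value and Young inequalities for powers -/

section PowerInequalities

/-- The difference of the two sides is `(x^s - y^s) (x^t - y^t)`. As `s` and `t` have the same
parity, both factors have the same sign, even for negative `x` or `y`. -/
lemma pow_mul_pow_add_le_of_even {s t : ℕ} (h : Even (s + t)) (x y : ℝ) :
    x ^ s * y ^ t + x ^ t * y ^ s ≤ x ^ (s + t) + y ^ (s + t) := by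
  suffices 0 ≤ (x ^ s - y ^ s) * (x ^ t - y ^ t) by
    rw [pow_add, pow_add]
    linarith
  rcases Nat.even_or_odd s with hs | hs
  · have ht : Even t := (Nat.even_add.1 h).1 hs
    obtain ⟨u, rfl⟩ := hs
    obtain ⟨v, rfl⟩ := ht
    simp only [← two_mul, pow_mul]
    rcases le_total (x ^ 2) (y ^ 2) with hxy | hxy
    · exact mul_nonneg_of_nonpos_of_nonpos
        (sub_nonpos.2 (pow_le_pow_left₀ (sq_nonneg x) hxy u))
        (sub_nonpos.2 (pow_le_pow_left₀ (sq_nonneg x) hxy v))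
    · exact mul_nonneg
        (sub_nonneg.2 (pow_le_pow_left₀ (sq_nonneg y) hxy u))
        (sub_nonneg.2 (pow_le_pow_left₀ (sq_nonneg y) hxy v))
  · have ht : Odd t := by
      rcases Nat.even_or_odd t with ht | ht
      · exact absurd ((Nat.even_add.1 h).2 ht) (Nat.not_even_iff_odd.2 hs)
      · exact ht
    rcases le_total x y with hxy | hxy
    · exact mul_nonneg_of_nonpos_of_nonpos
        (sub_nonpos.2 (hs.strictMono_pow.monotone hxy))
        (sub_nonpos.2 (ht.strictMono_pow.monotone hxy))
    · exact mul_nonneg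
        (sub_nonneg.2 (hs.strictMono_pow.monotone hxy))
        (sub_nonneg.2 (ht.strictMono_pow.monotone hxy))

lemma pow_mul_pow_add_le_of_nonneg {x y : ℝ} (hx : 0 ≤ x) (hy : 0 ≤ y) (s t : ℕ) :
    x ^ s * y ^ t + x ^ t * y ^ s ≤ x ^ (s + t) + y ^ (s + t) := by
  suffices 0 ≤ (x ^ s - y ^ s) * (x ^ t - y ^ t) by
    rw [pow_add, pow_add]
    linarith
  rcases le_total x y with hxy | hxy
  · exact mul_nonneg_of_nonpos_of_nonpos
      (sub_nonpos.2 (pow_le_pow_left₀ hx hxy s)) (sub_nonpos.2 (pow_le_pow_left₀ hx hxy t))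
  · exact mul_nonneg
      (sub_nonneg.2 (pow_le_pow_left₀ hy hxy s)) (sub_nonneg.2 (pow_le_pow_left₀ hy hxy t))

lemma geom_sum₂_le {m : ℕ} {x y : ℝ}
    (h : ∀ s t, s + t = m → x ^ s * y ^ t + x ^ t * y ^ s ≤ x ^ m + y ^ m) :
    ∑ s ∈ Finset.range (m + 1), x ^ s * y ^ (m - s) ≤ (m + 1) / 2 * (x ^ m + y ^ m) := by
  have h1 := Finset.sum_range_reflect (fun s => x ^ s * y ^ (m - s)) (m + 1)
  have h2 : ∑ s ∈ Finset.range (m + 1), (x ^ s * y ^ (m - s) + x ^ (m - s) * y ^ s) ≤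
      ∑ _s ∈ Finset.range (m + 1), (x ^ m + y ^ m) :=
    Finset.sum_le_sum fun s hs => h s (m - s) (by have := Finset.mem_range.1 hs; omega)
  have h3 : ∑ s ∈ Finset.range (m + 1), x ^ (m - s) * y ^ s =
      ∑ s ∈ Finset.range (m + 1), x ^ s * y ^ (m - s) := by
    rw [← h1]
    refine Finset.sum_congr rfl fun s hs => ?_
    have := Finset.mem_range.1 hs
    congr 2; omega
  rw [Finset.sum_add_distrib, h3, Finset.sum_const, Finset.card_range, nsmul_eq_mul] at h2
  push_cast at h2
  linarith

/-- Expand the difference of powers as a geometric sum and pair each term with its mirror image.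
Applied to eigenvalues, this becomes the trace inequality. -/
lemma sub_mul_pow_sub_pow_le {m : ℕ} (hm : Even m) (x y : ℝ) :
    (x - y) * (x ^ (m + 1) - y ^ (m + 1)) ≤
      (m + 1) / 2 * ((x - y) ^ 2 * (x ^ m + y ^ m)) := by
  have h1 := geom_sum₂_mul x y (m + 1)
  have h2 := geom_sum₂_le (x := x) (y := y) (m := m)
    fun s t hst => hst ▸ pow_mul_pow_add_le_of_even (hst ▸ hm) x y
  simp only [Nat.add_sub_cancel] at h1
  rw [← h1]
  nlinarith [mul_le_mul_of_nonneg_left h2 (sq_nonneg (x - y))]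

lemma pow_sub_pow_mul_sq_sub_sq_le {x y : ℝ} (hx : 0 ≤ x) (hy : 0 ≤ y) (N : ℕ) :
    (x ^ N - y ^ N) * (x ^ 2 - y ^ 2) ≤ N * ((x ^ N + y ^ N) * (x - y) ^ 2) := by
  cases N with
  | zero => simp
  | succ m =>
    have h1 := geom_sum₂_mul x y (m + 1)
    have h2 := geom_sum₂_le (x := x) (y := y) (m := m)
      fun s t hst => hst ▸ pow_mul_pow_add_le_of_nonneg hx hy s t
    have h3 := pow_mul_pow_add_le_of_nonneg hx hy m 1
    simp only [Nat.add_sub_cancel] at h1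
    rw [← h1]
    push_cast
    have h4 : (x + y) * ∑ s ∈ Finset.range (m + 1), x ^ s * y ^ (m - s) ≤
        (m + 1) * (x ^ (m + 1) + y ^ (m + 1)) := by
      calc _ ≤ (x + y) * ((m + 1) / 2 * (x ^ m + y ^ m)) := by gcongr
        _ = (m + 1) / 2 * ((x ^ (m + 1) + y ^ (m + 1)) + (x ^ m * y ^ 1 + x ^ 1 * y ^ m)) := by
          ring
        _ ≤ (m + 1) / 2 * ((x ^ (m + 1) + y ^ (m + 1)) + (x ^ (m + 1) + y ^ (m + 1))) := by
          gcongr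
        _ = _ := by ring
    nlinarith [mul_le_mul_of_nonneg_left h4 (sq_nonneg (x - y))]

/-- Young's inequality with exponents `m + 1` and `(m + 1) / m`, obtained from Bernoulli's
inequality for `a / y`. Its factor `m` on the right is what lets a moment be absorbed into itself
later. -/
lemma mul_pow_le_pow_add_pow {a y : ℝ} (ha : 0 ≤ a) (hy : 0 ≤ y) (m : ℕ) :
    (m + 1) * (a * y ^ m) ≤ a ^ (m + 1) + m * y ^ (m + 1) := by
  rcases hy.eq_or_lt with rfl | hy
  · cases m with
    | zero => simp
    | succ m => simp; positivity
  · have h := one_add_mul_le_pow (a := a / y - 1) (by have : 0 ≤ a / y := by positivity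
                                                      linarith) (m + 1)
    have h2 := mul_le_mul_of_nonneg_right h (pow_pos hy (m + 1)).le
    rw [add_sub_cancel, ← mul_pow, div_mul_cancel₀ _ hy.ne'] at h2
    have e : a / y * y = a := div_mul_cancel₀ _ hy.ne'
    push_cast at h2
    have e2 : (1 + ((m : ℝ) + 1) * (a / y - 1)) * y ^ (m + 1) =
        (m + 1) * (a * y ^ m) - m * y ^ (m + 1) := by
      rw [pow_succ]
      linear_combination (((m : ℝ) + 1) * y ^ m) * e
    linarith

end PowerInequalities

/-! ### Spectral calculus and trace inequalities for symmetric matrices -/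

section Trace

variable {n : ℕ}

lemma exists_eigendecomposition {X : Matrix (Fin n) (Fin n) ℝ} (hX : Xᵀ = X) :
    ∃ (Q : Matrix (Fin n) (Fin n) ℝ) (d : Fin n → ℝ), Qᵀ * Q = 1 ∧ Q * Qᵀ = 1 ∧
      X = Q * Matrix.diagonal d * Qᵀ := by
  have hH : X.IsHermitian := by
    rw [Matrix.IsHermitian, Matrix.conjTranspose_eq_transpose_of_trivial, hX]
  have h1 := Unitary.star_mul_self_of_mem hH.eigenvectorUnitary.2
  have h2 := Unitary.mul_star_self_of_mem hH.eigenvectorUnitary.2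
  rw [Matrix.star_eq_conjTranspose, Matrix.conjTranspose_eq_transpose_of_trivial] at h1 h2
  refine ⟨hH.eigenvectorUnitary, hH.eigenvalues, h1, h2, ?_⟩
  have h3 := hH.spectral_theorem
  rw [Unitary.conjStarAlgAut_apply, Matrix.star_eq_conjTranspose,
    Matrix.conjTranspose_eq_transpose_of_trivial] at h3
  exact h3

lemma conj_diagonal_pow {Q : Matrix (Fin n) (Fin n) ℝ} (hQ : Qᵀ * Q = 1) (hQ' : Q * Qᵀ = 1)
    (d : Fin n → ℝ) (k : ℕ) :
    (Q * Matrix.diagonal d * Qᵀ) ^ k = Q * Matrix.diagonal (d ^ k) * Qᵀ := by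
  induction k with
  | zero => simp [hQ']
  | succ k ih =>
    rw [pow_succ, ih, pow_succ]
    calc _ = Q * Matrix.diagonal (d ^ k) * (Qᵀ * Q) * Matrix.diagonal d * Qᵀ := by
          simp only [Matrix.mul_assoc]
      _ = _ := by
          rw [hQ, Matrix.mul_one, Matrix.mul_assoc Q, Matrix.diagonal_mul_diagonal]
          rfl

lemma trace_mul_transpose_eq_sum {Q P : Matrix (Fin n) (Fin n) ℝ} (hQ' : Q * Qᵀ = 1)
    (hP' : P * Pᵀ = 1) (F G : Matrix (Fin n) (Fin n) ℝ) :
    (F * Gᵀ).trace = ∑ i, ∑ j, (Qᵀ * F * P) i j * (Qᵀ * G * P) i j := by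
  have h : (Qᵀ * F * P * (Qᵀ * G * P)ᵀ).trace = (F * Gᵀ).trace := by
    simp only [Matrix.transpose_mul, Matrix.transpose_transpose]
    calc _ = (Qᵀ * (F * (P * Pᵀ) * Gᵀ * Q)).trace := by simp only [Matrix.mul_assoc]
      _ = (F * Gᵀ * (Q * Qᵀ)).trace := by
        rw [Matrix.trace_mul_comm, hP', Matrix.mul_one]
        simp only [Matrix.mul_assoc]
      _ = _ := by rw [hQ', Matrix.mul_one]
  rw [← h]
  refine Finset.sum_congr rfl fun i _ => ?_
  rw [Matrix.diag_apply, Matrix.mul_apply]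
  rfl

/-- Mean value inequality for the trace of powers of symmetric matrices. -/
lemma trace_sub_mul_pow_sub_pow_le {X Y : Matrix (Fin n) (Fin n) ℝ} (hX : Xᵀ = X) (hY : Yᵀ = Y)
    {m : ℕ} (hm : Even m) :
    ((X - Y) * (X ^ (m + 1) - Y ^ (m + 1))).trace ≤
      (m + 1) / 2 * ((X - Y) * (X - Y) * (X ^ m + Y ^ m)).trace := by
  obtain ⟨Q, a, hQ, hQ', hXd⟩ := exists_eigendecomposition hX
  obtain ⟨P, b, hP, hP', hYd⟩ := exists_eigendecomposition hY
  set W := Qᵀ * P with hW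
  have eX : ∀ k, Qᵀ * X ^ k = Matrix.diagonal (a ^ k) * Qᵀ := by
    intro k
    rw [hXd, conj_diagonal_pow hQ hQ', ← Matrix.mul_assoc, ← Matrix.mul_assoc, hQ, Matrix.one_mul]
  have eY : ∀ k, Y ^ k * P = P * Matrix.diagonal (b ^ k) := by
    intro k
    rw [hYd, conj_diagonal_pow hP hP', Matrix.mul_assoc, hP, Matrix.mul_one]
  have hT : ∀ k i j, (Qᵀ * (X ^ k - Y ^ k) * P) i j = (a i ^ k - b j ^ k) * W i j := by
    intro k i j
    rw [Matrix.mul_sub, Matrix.sub_mul, eX, Matrix.mul_assoc Qᵀ (Y ^ k), eY, Matrix.mul_assoc,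
      ← Matrix.mul_assoc Qᵀ P, ← hW, Matrix.sub_apply, Matrix.diagonal_mul, Matrix.mul_diagonal]
    simp only [Pi.pow_apply]
    ring
  have hT1 : ∀ i j, (Qᵀ * (X - Y) * P) i j = (a i - b j) * W i j := by
    intro i j
    have := hT 1 i j
    simpa only [pow_one] using this
  have hpX : ∀ k, (X ^ k)ᵀ = X ^ k := fun k => by rw [Matrix.transpose_pow, hX]
  have hpY : ∀ k, (Y ^ k)ᵀ = Y ^ k := fun k => by rw [Matrix.transpose_pow, hY]
  have hD : (X - Y)ᵀ = X - Y := by rw [Matrix.transpose_sub, hX, hY]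
  have e1 : ((X - Y) * (X ^ (m + 1) - Y ^ (m + 1))).trace =
      ∑ i, ∑ j, (a i - b j) * (a i ^ (m + 1) - b j ^ (m + 1)) * W i j ^ 2 := by
    have h : X ^ (m + 1) - Y ^ (m + 1) = (X ^ (m + 1) - Y ^ (m + 1))ᵀ := by
      rw [Matrix.transpose_sub, hpX, hpY]
    rw [h, trace_mul_transpose_eq_sum hQ' hP']
    refine Finset.sum_congr rfl fun i _ => Finset.sum_congr rfl fun j _ => ?_
    rw [hT1, hT]
    ring
  have e2 : ((X - Y) * (X - Y) * X ^ m).trace =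
      ∑ i, ∑ j, (a i - b j) ^ 2 * a i ^ m * W i j ^ 2 := by
    have h : (X - Y) * (X - Y) * X ^ m = (X - Y) * (X ^ m * (X - Y))ᵀ := by
      rw [Matrix.transpose_mul, hD, hpX, Matrix.mul_assoc]
    rw [h, trace_mul_transpose_eq_sum hQ' hP']
    refine Finset.sum_congr rfl fun i _ => Finset.sum_congr rfl fun j _ => ?_
    have h' : Qᵀ * (X ^ m * (X - Y)) * P = Matrix.diagonal (a ^ m) * (Qᵀ * (X - Y) * P) := by
      rw [← Matrix.mul_assoc Qᵀ, eX]
      simp only [Matrix.mul_assoc]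
    rw [h', Matrix.diagonal_mul, hT1]
    simp only [Pi.pow_apply]
    ring
  have e3 : ((X - Y) * (X - Y) * Y ^ m).trace =
      ∑ i, ∑ j, (a i - b j) ^ 2 * b j ^ m * W i j ^ 2 := by
    have h : ((X - Y) * (X - Y) * Y ^ m).trace = ((X - Y) * ((X - Y) * Y ^ m)ᵀ).trace := by
      rw [Matrix.transpose_mul, hD, hpY, ← Matrix.mul_assoc, Matrix.trace_mul_comm,
        Matrix.mul_assoc (X - Y) (Y ^ m), Matrix.trace_mul_comm (X - Y) (Y ^ m * (X - Y)),
        Matrix.mul_assoc]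
    rw [h, trace_mul_transpose_eq_sum hQ' hP']
    refine Finset.sum_congr rfl fun i _ => Finset.sum_congr rfl fun j _ => ?_
    have h' : Qᵀ * ((X - Y) * Y ^ m) * P = Qᵀ * (X - Y) * P * Matrix.diagonal (b ^ m) := by
      rw [Matrix.mul_assoc Qᵀ, Matrix.mul_assoc (X - Y), eY]
      simp only [Matrix.mul_assoc]
    rw [h', Matrix.mul_diagonal, hT1]
    simp only [Pi.pow_apply]
    ring
  rw [Matrix.mul_add, Matrix.trace_add, e1, e2, e3]
  simp only [← Finset.sum_add_distrib, Finset.mul_sum]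
  refine Finset.sum_le_sum fun i _ => Finset.sum_le_sum fun j _ => ?_
  have := mul_le_mul_of_nonneg_right (sub_mul_pow_sub_pow_le hm (a i) (b j)) (sq_nonneg (W i j))
  linarith

lemma orthogonal_norm_le_one {k : ℕ} {Q : Matrix (Fin n) (Fin k) ℝ} (hQ : Qᵀ * Q = 1) :
    ‖Q‖ ≤ 1 := by
  have h := Matrix.l2_opNorm_conjTranspose_mul_self Q
  rw [Matrix.conjTranspose_eq_transpose_of_trivial, hQ] at h
  have h1 : ‖(1 : Matrix (Fin k) (Fin k) ℝ)‖ ≤ 1 := by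
    rw [← Matrix.diagonal_one, Matrix.l2_opNorm_diagonal]
    exact (pi_norm_le_iff_of_nonneg zero_le_one).2 fun i => by simp
  rw [h] at h1
  nlinarith [norm_nonneg Q]

lemma norm_transpose {k l : ℕ} (X : Matrix (Fin k) (Fin l) ℝ) : ‖Xᵀ‖ = ‖X‖ := by
  rw [← Matrix.conjTranspose_eq_transpose_of_trivial, Matrix.l2_opNorm_conjTranspose]

lemma trace_conj_diagonal {Q : Matrix (Fin n) (Fin n) ℝ} (hQ : Qᵀ * Q = 1) (d : Fin n → ℝ) :
    (Q * Matrix.diagonal d * Qᵀ).trace = ∑ i, d i := by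
  rw [Matrix.mul_assoc, Matrix.trace_mul_comm, Matrix.mul_assoc, hQ, Matrix.mul_one,
    Matrix.trace_diagonal]

lemma norm_pow_le_trace_pow {X : Matrix (Fin n) (Fin n) ℝ} (hX : Xᵀ = X) {q : ℕ} (hq : 0 < q) :
    ‖X‖ ^ (2 * q) ≤ (X ^ (2 * q)).trace := by
  obtain ⟨Q, d, hQ, hQ', hXd⟩ := exists_eigendecomposition hX
  have h1 : ‖X‖ ≤ ‖d‖ := by
    calc ‖X‖ = ‖Q * Matrix.diagonal d * Qᵀ‖ := by rw [← hXd]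
      _ ≤ ‖Q‖ * ‖Matrix.diagonal d‖ * ‖Qᵀ‖ :=
        (Matrix.l2_opNorm_mul _ _).trans (by gcongr; exact Matrix.l2_opNorm_mul _ _)
      _ ≤ 1 * ‖d‖ * 1 := by
        rw [norm_transpose, Matrix.l2_opNorm_diagonal]
        gcongr <;> exact orthogonal_norm_le_one hQ
      _ = ‖d‖ := by ring
  have h2 : ‖d‖ ^ (2 * q) ≤ ∑ i, d i ^ (2 * q) := by
    have hnn : ∀ i ∈ Finset.univ, 0 ≤ d i ^ (2 * q) := fun i _ => by
      rw [pow_mul]; positivity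
    rcases isEmpty_or_nonempty (Fin n) with he | he
    · have : ‖d‖ = 0 := by rw [Subsingleton.elim d 0, norm_zero]
      rw [this, zero_pow (by omega)]
      exact Finset.sum_nonneg hnn
    · obtain ⟨i, hi⟩ := Finite.exists_max fun i => ‖d i‖
      calc ‖d‖ ^ (2 * q) ≤ ‖d i‖ ^ (2 * q) :=
            pow_le_pow_left₀ (norm_nonneg _) ((pi_norm_le_iff_of_nonneg (norm_nonneg _)).2 hi) _
        _ = d i ^ (2 * q) := by rw [Real.norm_eq_abs, Even.pow_abs (even_two_mul q)]
        _ ≤ _ := Finset.single_le_sum hnn (Finset.mem_univ i)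
  have h3 : (X ^ (2 * q)).trace = ∑ i, d i ^ (2 * q) := by
    rw [hXd, conj_diagonal_pow hQ hQ', trace_conj_diagonal hQ]
    rfl
  rw [h3]
  exact (pow_le_pow_left₀ (norm_nonneg _) h1 _).trans h2

/-- A diagonal entry of a power of `X` is an average of powers of eigenvalues with weights `Q k l ^
2`, so Young's inequality can be averaged. This replaces a Hölder inequality for Schatten norms. -/
lemma sum_mul_pow_diag_le {X : Matrix (Fin n) (Fin n) ℝ} (hX : Xᵀ = X) (m : ℕ)
    {a : Fin n → ℝ} (ha : ∀ k, 0 ≤ a k) :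
    (m + 1) * ∑ k, a k * (X ^ (2 * m)) k k ≤
      ∑ k, a k ^ (m + 1) + m * (X ^ (2 * (m + 1))).trace := by
  obtain ⟨Q, d, hQ, hQ', hXd⟩ := exists_eigendecomposition hX
  have hdiag : ∀ j k, (X ^ j) k k = ∑ l, Q k l ^ 2 * d l ^ j := by
    intro j k
    rw [hXd, conj_diagonal_pow hQ hQ', Matrix.mul_apply]
    refine Finset.sum_congr rfl fun l _ => ?_
    rw [Matrix.mul_diagonal, Matrix.transpose_apply, Pi.pow_apply]
    ring
  have hrow : ∀ k, ∑ l, Q k l ^ 2 = 1 := by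
    intro k
    have := congrFun (congrFun hQ' k) k
    rw [Matrix.mul_apply, Matrix.one_apply_eq] at this
    rw [← this]
    exact Finset.sum_congr rfl fun l _ => by rw [Matrix.transpose_apply]; ring
  have e : ∑ k, a k ^ (m + 1) + m * (X ^ (2 * (m + 1))).trace =
      ∑ k, ∑ l, Q k l ^ 2 * (a k ^ (m + 1) + m * (d l ^ 2) ^ (m + 1)) := by
    simp only [Matrix.trace, Matrix.diag, hdiag, mul_add, Finset.sum_add_distrib, Finset.mul_sum]
    congr 1
    · refine Finset.sum_congr rfl fun k _ => ?_
      rw [← Finset.sum_mul, hrow, one_mul]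
    · refine Finset.sum_congr rfl fun k _ => Finset.sum_congr rfl fun l _ => ?_
      rw [← pow_mul, mul_add 2]
      ring
  rw [e]
  simp only [hdiag, Finset.mul_sum]
  refine Finset.sum_le_sum fun k _ => Finset.sum_le_sum fun l _ => ?_
  have := mul_le_mul_of_nonneg_left
    (mul_pow_le_pow_add_pow (ha k) (sq_nonneg (d l)) m) (sq_nonneg (Q k l))
  rw [pow_mul]
  linarith

end Trace

/-! ### Moment and tail bounds for sums of independent matrices and vectors -/

section Moments

set_option linter.unusedSectionVars false

variable {ι : Type*} [Fintype ι] [DecidableEq ι]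

/-- The sum of the vectors `y w`, weighted by independent centered coins. -/
def coinSum {E : Type*} [AddCommGroup E] [Module ℝ E] (p : ℝ) (y : ι → E) (b : ι → Bool) : E :=
  ∑ w, coin p (b w) • y w

lemma coinSum_update_sub {E : Type*} [AddCommGroup E] [Module ℝ E] (p : ℝ) (y : ι → E)
    (b : ι → Bool) (w : ι) :
    coinSum p y (Function.update b w true) - coinSum p y (Function.update b w false) =
      p⁻¹ • y w := by
  rw [coinSum, coinSum, ← Finset.sum_sub_distrib, Finset.sum_eq_single w]
  · simp only [Function.update_self]
    rw [← sub_smul]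
    simp [coin]
  · intro v _ hv
    simp [Function.update_of_ne hv]
  · simp

lemma coinSum_transpose {n : ℕ} (p : ℝ) {y : ι → Matrix (Fin n) (Fin n) ℝ}
    (hy : ∀ w, (y w)ᵀ = y w) (b : ι → Bool) : (coinSum p y b)ᵀ = coinSum p y b := by
  simp [coinSum, Matrix.transpose_sum, hy]

/-- Matrix moment bound for a sum of independent symmetric matrices with diagonal squares. -/
lemma bernE_trace_pow_le {n : ℕ} {p : ℝ} (hp : 0 < p) (hp1 : p ≤ 1)
    {y : ι → Matrix (Fin n) (Fin n) ℝ} {g : ι → Fin n → ℝ} (hy : ∀ w, (y w)ᵀ = y w)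
    (hg : ∀ w, y w * y w = Matrix.diagonal (g w)) (hg0 : ∀ w k, 0 ≤ g w k) (m : ℕ) :
    bernE p (fun b => (coinSum p y b ^ (2 * (m + 1))).trace) ≤
      ∑ k, bernE p (fun b => ((m + 1) * ∑ w, coinSq p (b w) * g w k) ^ (m + 1)) := by
  set X := coinSum p y with hXdef
  have hX : ∀ b, (X b)ᵀ = X b := coinSum_transpose p hy
  -- The constant of the mean value inequality for the power `2 m + 1`.
  set c : ℝ := ((2 * m : ℕ) + 1) / 2 with hc
  have hc0 : 0 ≤ c := by positivity
  have hcm : c ≤ m + 1 := by rw [hc]; push_cast; linarith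
  have step1 : bernE p (fun b => (X b ^ (2 * (m + 1))).trace) ≤
      ∑ w, c * bernE p (fun b => coinSq p (b w) * (y w * y w * X b ^ (2 * m)).trace) := by
    have e : (fun b => (X b ^ (2 * (m + 1))).trace) =
        fun b => ∑ w, coin p (b w) * (y w * X b ^ (2 * m + 1)).trace := by
      ext b
      have e1 : X b ^ (2 * (m + 1)) = ∑ w, coin p (b w) • (y w * X b ^ (2 * m + 1)) := by
        rw [show 2 * (m + 1) = (2 * m + 1) + 1 by ring, pow_succ' (X b) (2 * m + 1)]
        conv_lhs => rw [show X b * X b ^ (2 * m + 1) =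
          (∑ w, coin p (b w) • y w) * X b ^ (2 * m + 1) from rfl]
        rw [Finset.sum_mul]
        simp only [Matrix.smul_mul]
      rw [e1, Matrix.trace_sum]
      simp only [Matrix.trace_smul, smul_eq_mul]
    rw [e, bernE_sum]
    refine Finset.sum_le_sum fun w _ => bernE_coin_mul_le hp hp1 w c _ _ fun b => ?_
    have h := trace_sub_mul_pow_sub_pow_le (hX (Function.update b w true))
      (hX (Function.update b w false)) (even_two_mul m)
    rw [hXdef, coinSum_update_sub, ← hXdef] at h
    simp only [Matrix.smul_mul, Matrix.mul_smul, Matrix.trace_smul, smul_eq_mul,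
      Matrix.mul_sub, Matrix.mul_add, Matrix.trace_sub, Matrix.trace_add] at h
    have h2 := mul_le_mul_of_nonneg_left h hp.le
    have hpi : p * p⁻¹ = 1 := mul_inv_cancel₀ hp.ne'
    set t1 := (y w * X (Function.update b w true) ^ (2 * m + 1)).trace
    set t0 := (y w * X (Function.update b w false) ^ (2 * m + 1)).trace
    set h1 := (y w * y w * X (Function.update b w true) ^ (2 * m)).trace
    set h0 := (y w * y w * X (Function.update b w false) ^ (2 * m)).trace
    calc t1 - t0 = p * p⁻¹ * (t1 - t0) := by rw [hpi, one_mul]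
      _ = p * (p⁻¹ * t1 - p⁻¹ * t0) := by ring
      _ ≤ _ := h2
      _ = (p * p⁻¹) * (c * p⁻¹ * (h1 + h0)) := by ring
      _ = _ := by rw [hpi, one_mul]
  have e2 : ∑ w, c * bernE p (fun b => coinSq p (b w) * (y w * y w * X b ^ (2 * m)).trace) =
      bernE p (fun b => ∑ k, (c * ∑ w, coinSq p (b w) * g w k) * (X b ^ (2 * m)) k k) := by
    simp only [← bernE_const_mul]
    rw [← bernE_sum]
    congr 1
    ext b
    simp only [hg, Matrix.trace, Matrix.diag_apply, Matrix.diagonal_mul, Finset.mul_sum,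
      Finset.sum_mul]
    rw [Finset.sum_comm]
    exact Finset.sum_congr rfl fun k _ => Finset.sum_congr rfl fun w _ => by ring
  have hD : ∀ (b : ι → Bool) k, 0 ≤ ∑ w, coinSq p (b w) * g w k := fun b k =>
    Finset.sum_nonneg fun w _ => mul_nonneg (coinSq_nonneg hp hp1 _) (hg0 w k)
  have step2 : (m + 1) *
      bernE p (fun b => ∑ k, (c * ∑ w, coinSq p (b w) * g w k) * (X b ^ (2 * m)) k k) ≤
      bernE p (fun b => ∑ k, (c * ∑ w, coinSq p (b w) * g w k) ^ (m + 1)) +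
        m * bernE p (fun b => (X b ^ (2 * (m + 1))).trace) := by
    rw [← bernE_const_mul, ← bernE_const_mul, ← bernE_add]
    exact bernE_mono hp.le hp1 fun b => sum_mul_pow_diag_le (hX b) m
      fun k => mul_nonneg hc0 (hD b k)
  have step3 : bernE p (fun b => ∑ k, (c * ∑ w, coinSq p (b w) * g w k) ^ (m + 1)) ≤
      ∑ k, bernE p (fun b => ((m + 1) * ∑ w, coinSq p (b w) * g w k) ^ (m + 1)) := by
    rw [← bernE_sum]
    refine bernE_mono hp.le hp1 fun b => Finset.sum_le_sum fun k _ => ?_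
    exact pow_le_pow_left₀ (mul_nonneg hc0 (hD b k))
      (mul_le_mul_of_nonneg_right hcm (hD b k)) _
  rw [e2] at step1
  have hm : (0 : ℝ) ≤ m := Nat.cast_nonneg m
  -- For the moment `T` on the left, the steps give `(m + 1) T ≤ S + m T` with `S` the right-hand
  -- side, hence `T ≤ S`.
  nlinarith [mul_le_mul_of_nonneg_left step1 (by positivity : (0 : ℝ) ≤ m + 1)]

/-- The vector counterpart of the trace inequality. The inner product splits into the mean of the
two weights times `‖s - t‖²` plus a term that depends only on the norms, which the scalar inequality
bounds. -/
lemma inner_sub_norm_pow_smul_le {F : Type*} [NormedAddCommGroup F] [InnerProductSpace ℝ F]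
    (s t : F) (m : ℕ) :
    inner ℝ (s - t) (‖s‖ ^ (2 * m) • s - ‖t‖ ^ (2 * m) • t) ≤
      ((2 * m : ℕ) + 1) / 2 * (‖s - t‖ ^ 2 * (‖s‖ ^ (2 * m) + ‖t‖ ^ (2 * m))) := by
  have h1 := pow_sub_pow_mul_sq_sub_sq_le (norm_nonneg s) (norm_nonneg t) (2 * m)
  have h2 : (‖s‖ - ‖t‖) ^ 2 ≤ ‖s - t‖ ^ 2 := by
    rw [← sq_abs (‖s‖ - ‖t‖)]
    exact pow_le_pow_left₀ (abs_nonneg _) (abs_norm_sub_norm_le s t) 2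
  set α := ‖s‖ ^ (2 * m)
  set β := ‖t‖ ^ (2 * m)
  have hα : 0 ≤ α := by positivity
  have hβ : 0 ≤ β := by positivity
  have e : inner ℝ (s - t) (α • s - β • t) =
      1 / 2 * (α + β) * ‖s - t‖ ^ 2 + 1 / 2 * ((α - β) * (‖s‖ ^ 2 - ‖t‖ ^ 2)) := by
    rw [norm_sub_sq_real]
    simp only [inner_sub_left, inner_sub_right, inner_smul_right, real_inner_self_eq_norm_sq,
      real_inner_comm t s]
    ring
  rw [e]
  have h3 : ((2 * m : ℕ) : ℝ) * ((α + β) * (‖s‖ - ‖t‖) ^ 2) ≤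
      ((2 * m : ℕ) : ℝ) * ((α + β) * ‖s - t‖ ^ 2) := by gcongr
  linarith

/-- Moment bound for a sum of independent vectors in a Euclidean space. -/
lemma bernE_norm_pow_le {F : Type*} [NormedAddCommGroup F] [InnerProductSpace ℝ F]
    {p : ℝ} (hp : 0 < p) (hp1 : p ≤ 1) (y : ι → F) (m : ℕ) :
    bernE p (fun b => ‖coinSum p y b‖ ^ (2 * (m + 1))) ≤
      bernE p (fun b => ((m + 1) * ∑ w, coinSq p (b w) * ‖y w‖ ^ 2) ^ (m + 1)) := by
  set X := coinSum p y with hXdef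
  set c : ℝ := ((2 * m : ℕ) + 1) / 2 with hc
  have hc0 : 0 ≤ c := by positivity
  have hcm : c ≤ m + 1 := by rw [hc]; push_cast; linarith
  have step1 : bernE p (fun b => ‖X b‖ ^ (2 * (m + 1))) ≤
      ∑ w, c * bernE p (fun b => coinSq p (b w) * (‖y w‖ ^ 2 * ‖X b‖ ^ (2 * m))) := by
    have e : (fun b => ‖X b‖ ^ (2 * (m + 1))) =
        fun b => ∑ w, coin p (b w) * inner ℝ (y w) (‖X b‖ ^ (2 * m) • X b) := by
      ext b
      have e1 : inner ℝ (X b) (‖X b‖ ^ (2 * m) • X b) = ‖X b‖ ^ (2 * (m + 1)) := by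
        rw [inner_smul_right, real_inner_self_eq_norm_sq]
        ring
      rw [← e1]
      conv_lhs => rw [show inner ℝ (X b) (‖X b‖ ^ (2 * m) • X b) =
        inner ℝ (∑ w, coin p (b w) • y w) (‖X b‖ ^ (2 * m) • X b) from rfl]
      rw [sum_inner]
      simp only [real_inner_smul_left]
    rw [e, bernE_sum]
    refine Finset.sum_le_sum fun w _ => bernE_coin_mul_le hp hp1 w c _ _ fun b => ?_
    have h := inner_sub_norm_pow_smul_le (X (Function.update b w true))
      (X (Function.update b w false)) m
    have e3 : X (Function.update b w true) - X (Function.update b w false) = p⁻¹ • y w := by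
      rw [hXdef, coinSum_update_sub]
    rw [e3, real_inner_smul_left, inner_sub_right, norm_smul, Real.norm_eq_abs,
      abs_of_pos (inv_pos.2 hp), mul_pow] at h
    have h2 := mul_le_mul_of_nonneg_left h hp.le
    have hpi : p * p⁻¹ = 1 := mul_inv_cancel₀ hp.ne'
    rw [← mul_assoc, hpi, one_mul] at h2
    refine h2.trans_eq ?_
    calc _ = (p * p⁻¹) * (c * p⁻¹ * (‖y w‖ ^ 2 * ‖X (Function.update b w true)‖ ^ (2 * m) +
            ‖y w‖ ^ 2 * ‖X (Function.update b w false)‖ ^ (2 * m))) := by rw [hc]; ring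
      _ = _ := by rw [hpi, one_mul]
  have e2 : ∑ w, c * bernE p (fun b => coinSq p (b w) * (‖y w‖ ^ 2 * ‖X b‖ ^ (2 * m))) =
      bernE p (fun b => (c * ∑ w, coinSq p (b w) * ‖y w‖ ^ 2) * ‖X b‖ ^ (2 * m)) := by
    simp only [← bernE_const_mul]
    rw [← bernE_sum]
    congr 1
    ext b
    simp only [Finset.mul_sum, Finset.sum_mul]
    exact Finset.sum_congr rfl fun w _ => by ring
  have hD : ∀ b : ι → Bool, 0 ≤ ∑ w, coinSq p (b w) * ‖y w‖ ^ 2 := fun b =>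
    Finset.sum_nonneg fun w _ => mul_nonneg (coinSq_nonneg hp hp1 _) (by positivity)
  have step2 : (m + 1) *
      bernE p (fun b => (c * ∑ w, coinSq p (b w) * ‖y w‖ ^ 2) * ‖X b‖ ^ (2 * m)) ≤
      bernE p (fun b => (c * ∑ w, coinSq p (b w) * ‖y w‖ ^ 2) ^ (m + 1)) +
        m * bernE p (fun b => ‖X b‖ ^ (2 * (m + 1))) := by
    rw [← bernE_const_mul, ← bernE_const_mul, ← bernE_add]
    refine bernE_mono hp.le hp1 fun b => ?_
    rw [pow_mul, pow_mul]
    exact mul_pow_le_pow_add_pow (mul_nonneg hc0 (hD b)) (sq_nonneg _) m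
  have step3 : bernE p (fun b => (c * ∑ w, coinSq p (b w) * ‖y w‖ ^ 2) ^ (m + 1)) ≤
      bernE p (fun b => ((m + 1) * ∑ w, coinSq p (b w) * ‖y w‖ ^ 2) ^ (m + 1)) :=
    bernE_mono hp.le hp1 fun b => pow_le_pow_left₀ (mul_nonneg hc0 (hD b))
      (mul_le_mul_of_nonneg_right hcm (hD b)) _
  rw [e2] at step1
  have hm : (0 : ℝ) ≤ m := Nat.cast_nonneg m
  nlinarith [mul_le_mul_of_nonneg_left step1 (by positivity : (0 : ℝ) ≤ m + 1)]

open Classical in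
/-- The probability of the event `s` under independent coin tosses. -/
def bernP (p : ℝ) (s : Set (ι → Bool)) : ℝ := bernE p (fun b => if b ∈ s then 1 else 0)

lemma bernP_mono {p : ℝ} (hp : 0 ≤ p) (hp1 : p ≤ 1) {s t : Set (ι → Bool)} (h : s ⊆ t) :
    bernP p s ≤ bernP p t := by
  refine bernE_mono hp hp1 fun b => ?_
  split_ifs with h1 h2 h2
  · exact le_rfl
  · exact absurd (h h1) h2
  · exact zero_le_one
  · exact le_rfl

lemma bernP_union_le {p : ℝ} (hp : 0 ≤ p) (hp1 : p ≤ 1) (s t : Set (ι → Bool)) :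
    bernP p (s ∪ t) ≤ bernP p s + bernP p t := by
  rw [bernP, bernP, bernP, ← bernE_add]
  refine bernE_mono hp hp1 fun b => ?_
  by_cases h1 : b ∈ s <;> by_cases h2 : b ∈ t <;> simp [h1, h2]

lemma bernP_iUnion_le {κ : Type*} [Fintype κ] {p : ℝ} (hp : 0 ≤ p) (hp1 : p ≤ 1)
    (s : κ → Set (ι → Bool)) : bernP p (⋃ k, s k) ≤ ∑ k, bernP p (s k) := by
  classical
  simp only [bernP]
  rw [← bernE_sum]
  refine bernE_mono hp hp1 fun b => ?_
  have hnn : ∀ k ∈ Finset.univ, (0 : ℝ) ≤ if b ∈ s k then 1 else 0 := fun k _ => by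
    split_ifs <;> norm_num
  split_ifs with h
  · obtain ⟨k, hk⟩ := Set.mem_iUnion.1 h
    have := Finset.single_le_sum hnn (Finset.mem_univ k)
    simpa [hk] using this
  · exact Finset.sum_nonneg hnn

lemma bernP_compl (p : ℝ) (s : Set (ι → Bool)) : bernP p sᶜ = 1 - bernP p s := by
  have h : bernP p sᶜ + bernP p s = 1 := by
    rw [bernP, bernP, ← bernE_add]
    refine Eq.trans ?_ (bernE_const (ι := ι) p 1)
    congr 1
    ext b
    by_cases hb : b ∈ s <;> simp [hb]
  linarith

/-- Fubini's theorem: an event that has probability at most `δ` for every fixed outcome outside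
of `S` has probability at most `δ`. -/
lemma bernP_le_of_resample {p : ℝ} (hp : 0 ≤ p) (hp1 : p ≤ 1) (S : Finset ι)
    {s : Set (ι → Bool)} {δ : ℝ} (h : ∀ b, bernP p {b' | S.piecewise b' b ∈ s} ≤ δ) :
    bernP p s ≤ δ := by
  rw [bernP, ← bernE_resample p S, ← bernE_const (ι := ι) p δ]
  exact bernE_mono hp hp1 h

/-- Markov's inequality. -/
lemma bernP_lt_mul_pow_le {p : ℝ} (hp : 0 ≤ p) (hp1 : p ≤ 1) {f : (ι → Bool) → ℝ}
    (hf : ∀ b, 0 ≤ f b) {t : ℝ} (ht : 0 ≤ t) (k : ℕ) :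
    bernP p {b | t < f b} * t ^ k ≤ bernE p (fun b => f b ^ k) := by
  rw [bernP, mul_comm, ← bernE_const_mul]
  refine bernE_mono hp hp1 fun b => ?_
  split_ifs with h
  · rw [mul_one]
    exact pow_le_pow_left₀ ht (le_of_lt h) k
  · rw [mul_zero]
    exact pow_nonneg (hf b) k

/-- The threshold is the `2q`-th root of the moment bound inflated by `e^{1/2}`: passing from `exp
4` to `exp 5` inside the root leaves the factor `exp (-q)` in Markov's inequality. -/
lemma exp_mul_pow_eq {p B : ℝ} (hp : 0 < p) (hB : 0 < B) (q : ℕ) :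
    (q : ℝ) ^ q * (Real.exp 4 * B / p) ^ q =
      Real.exp (-q) * Real.sqrt (Real.exp 5 * q * B / p) ^ (2 * q) := by
  have h : (0 : ℝ) ≤ Real.exp 5 * q * B / p := by positivity
  rw [pow_mul, Real.sq_sqrt h, ← mul_pow]
  have h2 : Real.exp (-(q : ℝ)) = Real.exp (-1) ^ q := by
    rw [← Real.exp_nat_mul]
    congr 1
    ring
  have h3 : Real.exp 4 = Real.exp (-1) * Real.exp 5 := by
    rw [← Real.exp_add]
    norm_num
  rw [h2, ← mul_pow, h3]
  congr 1
  ring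

/-- Tail bound for the norm of a sum of independent symmetric matrices with diagonal squares. -/
lemma bernP_norm_coinSum_matrix_le {n : ℕ} {p : ℝ} (hp : 0 < p) (hp1 : p ≤ 1)
    {y : ι → Matrix (Fin n) (Fin n) ℝ} {g : ι → Fin n → ℝ} (hy : ∀ w, (y w)ᵀ = y w)
    (hg : ∀ w, y w * y w = Matrix.diagonal (g w)) (hg0 : ∀ w k, 0 ≤ g w k)
    {q : ℕ} (hq : 0 < q) {B : ℝ} (hB : 0 < B) (hgB : ∀ k, ∑ w, g w k ≤ B)
    (hqg : ∀ w k, q * g w k ≤ p * B) :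
    bernP p {b | Real.sqrt (Real.exp 5 * q * B / p) < ‖coinSum p y b‖} ≤
      n * Real.exp (-q) := by
  have hq' : (0 : ℝ) < q := by exact_mod_cast hq
  set t := Real.sqrt (Real.exp 5 * q * B / p) with ht
  have ht0 : 0 < t := Real.sqrt_pos.2 (by positivity)
  have h1 := bernP_lt_mul_pow_le hp.le hp1 (fun b => norm_nonneg (coinSum p y b)) ht0.le (2 * q)
  have h2 : bernE p (fun b => ‖coinSum p y b‖ ^ (2 * q)) ≤
      bernE p (fun b => (coinSum p y b ^ (2 * q)).trace) :=
    bernE_mono hp.le hp1 fun b => norm_pow_le_trace_pow (coinSum_transpose p hy b) hq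
  obtain ⟨m, rfl⟩ : ∃ m, q = m + 1 := ⟨q - 1, by omega⟩
  have h3 := bernE_trace_pow_le hp hp1 hy hg hg0 m
  have h4 : ∑ k : Fin n, bernE p
      (fun b : ι → Bool => ((m + 1) * ∑ w, coinSq p (b w) * g w k) ^ (m + 1)) ≤
      n * (((m + 1 : ℕ) : ℝ) ^ (m + 1) * (Real.exp 4 * B / p) ^ (m + 1)) := by
    have : ∀ k ∈ Finset.univ, bernE p
        (fun b : ι → Bool => ((m + 1) * ∑ w, coinSq p (b w) * g w k) ^ (m + 1)) ≤
        ((m + 1 : ℕ) : ℝ) ^ (m + 1) * (Real.exp 4 * B / p) ^ (m + 1) := by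
      intro k _
      simp only [mul_pow]
      rw [bernE_const_mul]
      push_cast
      gcongr
      exact bernE_sum_coinSq_pow_le hp hp1 hq hB _ (fun w => hg0 w k) (hgB k) (fun w => hqg w k)
    refine (Finset.sum_le_sum this).trans_eq ?_
    simp
  rw [exp_mul_pow_eq hp hB, ← ht, ← mul_assoc] at h4
  exact le_of_mul_le_mul_right (h1.trans (h2.trans (h3.trans h4))) (by positivity)

/-- Tail bound for the norm of a sum of independent vectors in a Euclidean space. -/
lemma bernP_norm_coinSum_le {F : Type*} [NormedAddCommGroup F] [InnerProductSpace ℝ F]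
    {p : ℝ} (hp : 0 < p) (hp1 : p ≤ 1) (y : ι → F)
    {q : ℕ} (hq : 0 < q) {B : ℝ} (hB : 0 < B) (hyB : ∑ w, ‖y w‖ ^ 2 ≤ B)
    (hqy : ∀ w, q * ‖y w‖ ^ 2 ≤ p * B) :
    bernP p {b | Real.sqrt (Real.exp 5 * q * B / p) < ‖coinSum p y b‖} ≤ Real.exp (-q) := by
  have hq' : (0 : ℝ) < q := by exact_mod_cast hq
  set t := Real.sqrt (Real.exp 5 * q * B / p) with ht
  have ht0 : 0 < t := Real.sqrt_pos.2 (by positivity)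
  have h1 := bernP_lt_mul_pow_le hp.le hp1 (fun b => norm_nonneg (coinSum p y b)) ht0.le (2 * q)
  obtain ⟨m, rfl⟩ : ∃ m, q = m + 1 := ⟨q - 1, by omega⟩
  have h3 := bernE_norm_pow_le hp hp1 y m
  have h4 : bernE p
      (fun b : ι → Bool => ((m + 1) * ∑ w, coinSq p (b w) * ‖y w‖ ^ 2) ^ (m + 1)) ≤
      ((m + 1 : ℕ) : ℝ) ^ (m + 1) * (Real.exp 4 * B / p) ^ (m + 1) := by
    simp only [mul_pow]
    rw [bernE_const_mul]
    push_cast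
    gcongr
    exact bernE_sum_coinSq_pow_le hp hp1 hq hB _ (fun w => sq_nonneg _) hyB hqy
  rw [exp_mul_pow_eq hp hB, ← ht] at h4
  exact le_of_mul_le_mul_right (h1.trans (h3.trans h4)) (by positivity)

end Moments

/-! ### Row norms and the spectral norm -/

section Rows

variable {n r : ℕ}

/-- The `i`-th row of a matrix, as a vector of a Euclidean space. -/
def matRow {k : ℕ} (M : Matrix (Fin n) (Fin k) ℝ) (i : Fin n) : EuclideanSpace ℝ (Fin k) :=
  WithLp.toLp 2 (M i)

lemma norm_toLp_sq {k : ℕ} (x : Fin k → ℝ) :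
    ‖(WithLp.toLp 2 x : EuclideanSpace ℝ (Fin k))‖ ^ 2 = x ⬝ᵥ x := by
  rw [EuclideanSpace.norm_sq_eq]
  simp [dotProduct, sq]

lemma norm_matRow_sq {k : ℕ} (M : Matrix (Fin n) (Fin k) ℝ) (i : Fin n) :
    ‖matRow M i‖ ^ 2 = ∑ j, M i j ^ 2 := by
  rw [matRow, norm_toLp_sq]
  simp [dotProduct, sq]

lemma norm_matRow {k : ℕ} (M : Matrix (Fin n) (Fin k) ℝ) (i : Fin n) :
    ‖matRow M i‖ = Real.sqrt (∑ j, M i j ^ 2) := by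
  rw [← norm_matRow_sq, Real.sqrt_sq (norm_nonneg _)]

lemma norm_matRow_le_twoInfNorm (M : Matrix (Fin n) (Fin r) ℝ) (i : Fin n) :
    ‖matRow M i‖ ≤ twoInfNorm M := by
  rw [norm_matRow]
  exact le_ciSup (f := fun i => Real.sqrt (∑ k, M i k ^ 2)) (Set.finite_range _).bddAbove i

lemma twoInfNorm_nonneg (M : Matrix (Fin n) (Fin r) ℝ) : 0 ≤ twoInfNorm M :=
  Real.iSup_nonneg fun _ => Real.sqrt_nonneg _

lemma twoInfNorm_le {M : Matrix (Fin n) (Fin r) ℝ} {c : ℝ} (hc : 0 ≤ c)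
    (h : ∀ i, ‖matRow M i‖ ≤ c) : twoInfNorm M ≤ c :=
  Real.iSup_le (fun i => norm_matRow M i ▸ h i) hc

lemma matRow_add {k : ℕ} (M N : Matrix (Fin n) (Fin k) ℝ) (i : Fin n) :
    matRow (M + N) i = matRow M i + matRow N i := rfl

lemma matRow_sub {k : ℕ} (M N : Matrix (Fin n) (Fin k) ℝ) (i : Fin n) :
    matRow (M - N) i = matRow M i - matRow N i := rfl

lemma twoInfNorm_add_le (M N : Matrix (Fin n) (Fin r) ℝ) :
    twoInfNorm (M + N) ≤ twoInfNorm M + twoInfNorm N :=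
  twoInfNorm_le (add_nonneg (twoInfNorm_nonneg M) (twoInfNorm_nonneg N)) fun i => by
    rw [matRow_add]
    exact (norm_add_le _ _).trans
      (add_le_add (norm_matRow_le_twoInfNorm M i) (norm_matRow_le_twoInfNorm N i))

lemma norm_mulVec_le {k l : ℕ} (M : Matrix (Fin k) (Fin l) ℝ) (x : Fin l → ℝ) :
    ‖(WithLp.toLp 2 (M *ᵥ x) : EuclideanSpace ℝ (Fin k))‖ ≤
      ‖M‖ * ‖(WithLp.toLp 2 x : EuclideanSpace ℝ (Fin l))‖ :=
  Matrix.l2_opNorm_mulVec M (WithLp.toLp 2 x)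

lemma norm_le_of_mulVec_le {k l : ℕ} {M : Matrix (Fin k) (Fin l) ℝ} {c : ℝ} (hc : 0 ≤ c)
    (h : ∀ x : Fin l → ℝ, ‖(WithLp.toLp 2 (M *ᵥ x) : EuclideanSpace ℝ (Fin k))‖ ≤
      c * ‖(WithLp.toLp 2 x : EuclideanSpace ℝ (Fin l))‖) : ‖M‖ ≤ c := by
  rw [Matrix.l2_opNorm_def]
  exact ContinuousLinearMap.opNorm_le_bound _ hc fun x => h x.ofLp

lemma norm_matRow_mul_le {k l : ℕ} (M : Matrix (Fin n) (Fin k) ℝ) (N : Matrix (Fin k) (Fin l) ℝ)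
    (i : Fin n) : ‖matRow (M * N) i‖ ≤ ‖matRow M i‖ * ‖N‖ := by
  have h : (M * N) i = Nᵀ *ᵥ M i := by
    ext j
    simp [Matrix.mul_apply, Matrix.mulVec, dotProduct, mul_comm]
  rw [matRow, h, mul_comm, ← norm_transpose N]
  exact norm_mulVec_le Nᵀ (M i)

lemma abs_dotProduct_le {k : ℕ} (x y : Fin k → ℝ) :
    |x ⬝ᵥ y| ≤ ‖(WithLp.toLp 2 x : EuclideanSpace ℝ (Fin k))‖ *
      ‖(WithLp.toLp 2 y : EuclideanSpace ℝ (Fin k))‖ := by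
  have h := abs_real_inner_le_norm (WithLp.toLp 2 y : EuclideanSpace ℝ (Fin k)) (WithLp.toLp 2 x)
  rw [EuclideanSpace.inner_toLp_toLp, mul_comm] at h
  simpa using h

lemma norm_matRow_le_norm {k : ℕ} (M : Matrix (Fin n) (Fin k) ℝ) (i : Fin n) :
    ‖matRow M i‖ ≤ ‖M‖ := by
  have h : M i = Mᵀ *ᵥ Pi.single i 1 := by
    ext j
    simp
  rw [matRow, h]
  refine (norm_mulVec_le Mᵀ _).trans ?_
  rw [norm_transpose]
  have h1 : ‖(WithLp.toLp 2 (Pi.single i 1) : EuclideanSpace ℝ (Fin n))‖ ^ 2 = 1 := by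
    rw [norm_toLp_sq]
    simp
  have h2 : ‖(WithLp.toLp 2 (Pi.single i 1) : EuclideanSpace ℝ (Fin n))‖ ≤ 1 := by
    nlinarith [norm_nonneg (WithLp.toLp 2 (Pi.single i 1) : EuclideanSpace ℝ (Fin n))]
  nlinarith [norm_nonneg M]

lemma abs_quadForm_le {k : ℕ} (M : Matrix (Fin k) (Fin k) ℝ) (x : Fin k → ℝ) :
    |x ⬝ᵥ (M *ᵥ x)| ≤ ‖M‖ * (x ⬝ᵥ x) := by
  refine (abs_dotProduct_le x (M *ᵥ x)).trans ?_
  rw [← norm_toLp_sq]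
  nlinarith [norm_mulVec_le M x,
    norm_nonneg (WithLp.toLp 2 x : EuclideanSpace ℝ (Fin k))]

lemma norm_diagonal_single_mul_le {k : ℕ} (i : Fin n) (W : Matrix (Fin n) (Fin k) ℝ) :
    ‖Matrix.diagonal (Pi.single i (1 : ℝ)) * W‖ ≤ ‖matRow W i‖ := by
  refine norm_le_of_mulVec_le (norm_nonneg _) fun x => ?_
  have h : (Matrix.diagonal (Pi.single i (1 : ℝ)) * W) *ᵥ x = Pi.single i (W i ⬝ᵥ x) := by
    rw [← Matrix.mulVec_mulVec]
    ext j
    rw [Matrix.mulVec_diagonal]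
    by_cases hj : j = i
    · subst hj
      simp [Matrix.mulVec]
    · simp [hj]
  have h1 : ‖(WithLp.toLp 2 (Pi.single i (W i ⬝ᵥ x)) : EuclideanSpace ℝ (Fin n))‖ =
      |W i ⬝ᵥ x| := by
    rw [← Real.sqrt_sq (norm_nonneg _), norm_toLp_sq]
    simp [Real.sqrt_mul_self_eq_abs]
  rw [h, h1]
  exact abs_dotProduct_le _ _

lemma norm_diagonal_le {k : ℕ} {v : Fin k → ℝ} {c : ℝ} (hc : 0 ≤ c) (h : ∀ i, |v i| ≤ c) :
    ‖Matrix.diagonal v‖ ≤ c := by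
  rw [Matrix.l2_opNorm_diagonal]
  exact (pi_norm_le_iff_of_nonneg hc).2 h

lemma eq_mul_diagonal_mul_inv {k : ℕ} (D : Matrix (Fin n) (Fin k) ℝ) {v : Fin k → ℝ}
    (hv : ∀ i, v i ≠ 0) : D = D * Matrix.diagonal v * Matrix.diagonal (fun i => (v i)⁻¹) := by
  rw [Matrix.mul_assoc, Matrix.diagonal_mul_diagonal]
  simp [hv]

lemma norm_diagonal_inv_le {k : ℕ} {v : Fin k → ℝ} {s : ℝ} (hs : 0 < s) (hv : ∀ i, s ≤ v i) :
    ‖Matrix.diagonal (fun i => (v i)⁻¹)‖ ≤ s⁻¹ :=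
  norm_diagonal_le (by positivity) fun i => by
    rw [abs_of_pos (inv_pos.2 (hs.trans_le (hv i)))]
    exact inv_anti₀ hs (hv i)

lemma norm_le_of_mul_diagonal {k : ℕ} (D : Matrix (Fin n) (Fin k) ℝ) {v : Fin k → ℝ} {s : ℝ}
    (hs : 0 < s) (hv : ∀ i, s ≤ v i) : s * ‖D‖ ≤ ‖D * Matrix.diagonal v‖ := by
  have h := Matrix.l2_opNorm_mul (D * Matrix.diagonal v) (Matrix.diagonal (fun i => (v i)⁻¹))
  rw [← eq_mul_diagonal_mul_inv D (fun i => (hs.trans_le (hv i)).ne')] at h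
  have h2 := h.trans (mul_le_mul_of_nonneg_left (norm_diagonal_inv_le hs hv) (norm_nonneg _))
  rw [← div_eq_mul_inv, le_div_iff₀ hs] at h2
  linarith

lemma norm_matRow_le_of_mul_diagonal {k : ℕ} (D : Matrix (Fin n) (Fin k) ℝ) {v : Fin k → ℝ}
    {s : ℝ} (hs : 0 < s) (hv : ∀ i, s ≤ v i) (i : Fin n) :
    s * ‖matRow D i‖ ≤ ‖matRow (D * Matrix.diagonal v) i‖ := by
  have h := norm_matRow_mul_le (D * Matrix.diagonal v) (Matrix.diagonal (fun i => (v i)⁻¹)) i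
  rw [← eq_mul_diagonal_mul_inv D (fun i => (hs.trans_le (hv i)).ne')] at h
  have h2 := h.trans (mul_le_mul_of_nonneg_left (norm_diagonal_inv_le hs hv) (norm_nonneg _))
  rw [← div_eq_mul_inv, le_div_iff₀ hs] at h2
  linarith

end Rows

/-! ### Orthogonal Procrustes alignment -/

section Procrustes

variable {n r : ℕ}

lemma frobNorm_sq (M : Matrix (Fin n) (Fin r) ℝ) : frobNorm M ^ 2 = (Mᵀ * M).trace := by
  have h : 0 ≤ ∑ i, ∑ k, M i k ^ 2 :=
    Finset.sum_nonneg fun i _ => Finset.sum_nonneg fun k _ => sq_nonneg _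
  rw [frobNorm, Real.sq_sqrt h, Finset.sum_comm]
  simp [Matrix.trace, Matrix.mul_apply, sq]

lemma IsProcrustes.trace_le {Uhat U : Matrix (Fin n) (Fin r) ℝ} {R : Matrix (Fin r) (Fin r) ℝ}
    (h : IsProcrustes Uhat U R) (hUhat : Uhatᵀ * Uhat = 1) {O : Matrix (Fin r) (Fin r) ℝ}
    (hO : Oᵀ * O = 1) : (Uᵀ * Uhat * O).trace ≤ (Uᵀ * Uhat * R).trace := by
  have key : ∀ O : Matrix (Fin r) (Fin r) ℝ, Oᵀ * O = 1 →
      frobNorm (Uhat * O - U) ^ 2 =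
        (1 : Matrix (Fin r) (Fin r) ℝ).trace + (Uᵀ * U).trace - 2 * (Uᵀ * Uhat * O).trace := by
    intro O hO
    have e1 : (Uhat * O)ᵀ * (Uhat * O) = 1 := by
      rw [Matrix.transpose_mul, Matrix.mul_assoc, ← Matrix.mul_assoc Uhatᵀ, hUhat, Matrix.one_mul,
        hO]
    have e2 : ((Uhat * O)ᵀ * U).trace = (Uᵀ * Uhat * O).trace := by
      rw [← Matrix.trace_transpose, Matrix.transpose_mul, Matrix.transpose_transpose,
        Matrix.mul_assoc]
    rw [frobNorm_sq, Matrix.transpose_sub, Matrix.sub_mul, Matrix.mul_sub, Matrix.mul_sub, e1]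
    simp only [Matrix.trace_sub]
    rw [e2, Matrix.mul_assoc]
    ring
  have h1 := pow_le_pow_left₀ (Real.sqrt_nonneg _) (h.2 O hO) 2
  change frobNorm _ ^ 2 ≤ _ at h1
  rw [key O hO, key R h.1] at h1
  linarith

/-- Test the maximality with the reflection in the hyperplane orthogonal to `x`: it lowers the trace
by a positive multiple of the quadratic form at `x`. -/
lemma quadForm_nonneg_of_trace_le {T : Matrix (Fin r) (Fin r) ℝ}
    (hT : ∀ P : Matrix (Fin r) (Fin r) ℝ, Pᵀ * P = 1 → (T * P).trace ≤ T.trace) (x : Fin r → ℝ) :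
    0 ≤ x ⬝ᵥ (T *ᵥ x) := by
  rcases eq_or_ne x 0 with rfl | hx
  · simp
  have hxx : 0 < x ⬝ᵥ x := by
    rw [← norm_toLp_sq]
    have : (WithLp.toLp 2 x : EuclideanSpace ℝ (Fin r)) ≠ 0 := by simpa using hx
    positivity
  set c : ℝ := 2 / (x ⬝ᵥ x) with hc
  have hcx : c * (x ⬝ᵥ x) = 2 := div_mul_cancel₀ _ hxx.ne'
  have h := hT (1 - c • Matrix.vecMulVec x x) (by
    simp only [Matrix.transpose_sub, Matrix.transpose_smul, Matrix.transpose_one,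
      Matrix.transpose_vecMulVec, Matrix.sub_mul, Matrix.mul_sub, Matrix.one_mul, Matrix.mul_one,
      Matrix.smul_mul, Matrix.mul_smul, Matrix.vecMulVec_mul_vecMulVec]
    have : c • c • Matrix.vecMulVec x ((x ⬝ᵥ x) • x) = (2 * c) • Matrix.vecMulVec x x := by
      rw [Matrix.vecMulVec_smul, smul_smul, smul_smul]
      congr 1
      rw [mul_assoc, hcx, mul_comm]
    rw [smul_sub, this, two_mul, add_smul]
    abel)
  rw [Matrix.mul_sub, Matrix.mul_one, Matrix.mul_smul, Matrix.trace_sub, Matrix.trace_smul,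
    Matrix.mul_vecMulVec, Matrix.trace_vecMulVec, smul_eq_mul, dotProduct_comm] at h
  have hc0 : 0 < c := by positivity
  exact nonneg_of_mul_nonneg_right (by linarith) hc0

/-- Test the maximality with rotations of the plane of the coordinates `j` and `k`. The gain is of
first order in the angle, with coefficient `T k j - T j k`, while the loss is of second order. -/
lemma transpose_eq_of_trace_le {T : Matrix (Fin r) (Fin r) ℝ}
    (hT : ∀ P : Matrix (Fin r) (Fin r) ℝ, Pᵀ * P = 1 → (T * P).trace ≤ T.trace) : Tᵀ = T := by
  ext j k
  rw [Matrix.transpose_apply]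
  rcases eq_or_ne j k with rfl | hjk
  · rfl
  have hdiag : ∀ i, 0 ≤ T i i := fun i => by
    simpa using quadForm_nonneg_of_trace_le hT (Pi.single i 1)
  set J : Matrix (Fin r) (Fin r) ℝ := Matrix.single j j 1 + Matrix.single k k 1 with hJ
  set L : Matrix (Fin r) (Fin r) ℝ := Matrix.single j k 1 - Matrix.single k j 1 with hL
  have hJT : Jᵀ = J := by simp [hJ]
  have hLT : Lᵀ = -L := by simp [hL]
  have hJJ : J * J = J := by
    simp [hJ, Matrix.add_mul, Matrix.mul_add, hjk, hjk.symm]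
  have hJL : J * L = L := by
    simp [hJ, hL, Matrix.add_mul, Matrix.mul_sub, hjk, hjk.symm]
  have hLJ : L * J = L := by
    simp [hJ, hL, Matrix.sub_mul, Matrix.mul_add, hjk, hjk.symm]
    abel
  have hLL : L * L = -J := by
    simp [hJ, hL, Matrix.sub_mul, Matrix.mul_sub, hjk, hjk.symm]
    abel
  have hrot : ∀ c s : ℝ, c ^ 2 + s ^ 2 = 1 →
      s * (T k j - T j k) ≤ (1 - c) * (T j j + T k k) := by
    intro c s hcs
    have h := hT (1 + (c - 1) • J + s • L) (by
      simp only [Matrix.transpose_add, Matrix.transpose_smul, Matrix.transpose_one, hJT, hLT,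
        Matrix.add_mul, Matrix.mul_add, Matrix.one_mul, Matrix.mul_one, Matrix.smul_mul,
        Matrix.mul_smul, Matrix.neg_mul, hJJ, hJL, hLJ, hLL, smul_neg, neg_neg]
      have : s ^ 2 = 1 - c ^ 2 := by linarith
      match_scalars <;> linarith)
    simp only [Matrix.mul_add, Matrix.mul_smul, Matrix.trace_add,
      Matrix.trace_smul, smul_eq_mul, hJ, hL, Matrix.mul_sub, Matrix.trace_sub,
      Matrix.trace_mul_single, mul_one] at h
    simp at h
    linarith
  -- The rational parametrization of the circle turns the condition into a polynomial inequality.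
  -- Below, `t = α / (β + 1)` avoids dividing by `β`, which may vanish.
  have hrot' : ∀ t : ℝ, t * (T k j - T j k) ≤ t ^ 2 * (T j j + T k k) := by
    intro t
    have ht : 0 < 1 + t ^ 2 := by positivity
    have h := hrot ((1 - t ^ 2) / (1 + t ^ 2)) (2 * t / (1 + t ^ 2)) (by field_simp; ring)
    have e : (1 - (1 - t ^ 2) / (1 + t ^ 2)) = 2 * t ^ 2 / (1 + t ^ 2) := by field_simp; ring
    rw [e, div_mul_eq_mul_div, div_mul_eq_mul_div, div_le_div_iff_of_pos_right ht] at h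
    linarith
  set α := T k j - T j k with hα
  set β := T j j + T k k with hβ
  have hβ0 : 0 ≤ β := add_nonneg (hdiag j) (hdiag k)
  have h := hrot' (α / (β + 1))
  have h2 := mul_le_mul_of_nonneg_right h (sq_nonneg (β + 1))
  have e1 : α / (β + 1) * α * (β + 1) ^ 2 = α ^ 2 * (β + 1) := by field_simp
  have e2 : (α / (β + 1)) ^ 2 * β * (β + 1) ^ 2 = α ^ 2 * β := by field_simp
  rw [e1, e2] at h2
  have h3 : α ^ 2 = 0 := le_antisymm (by linarith) (sq_nonneg α)
  have h4 : α = 0 := by simpa using h3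
  rw [hα] at h4
  linarith

/-- Factor `T² - 1 = (T + 1) (T - 1)`; a nonnegative quadratic form for `T` means that `T + 1` does
not shorten vectors. -/
lemma norm_sub_one_le_of_psd {T : Matrix (Fin r) (Fin r) ℝ} (hT : ∀ x, 0 ≤ x ⬝ᵥ (T *ᵥ x)) :
    ‖T - 1‖ ≤ ‖T * T - 1‖ := by
  refine norm_le_of_mulVec_le (norm_nonneg _) fun x => ?_
  set y := (T - 1) *ᵥ x with hy
  have e : T *ᵥ y + y = (T * T - 1) *ᵥ x := by
    simp only [hy, Matrix.sub_mulVec, Matrix.one_mulVec, Matrix.mulVec_sub, Matrix.mulVec_mulVec]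
    abel
  have h1 : y ⬝ᵥ y ≤ y ⬝ᵥ ((T * T - 1) *ᵥ x) := by
    rw [← e, dotProduct_add]
    linarith [hT y]
  have h2 := (le_abs_self _).trans (abs_dotProduct_le y ((T * T - 1) *ᵥ x))
  have h3 := norm_mulVec_le (T * T - 1) x
  rw [← norm_toLp_sq] at h1
  rcases (norm_nonneg (WithLp.toLp 2 y : EuclideanSpace ℝ (Fin r))).eq_or_lt with h0 | h0
  · rw [← h0]
    positivity
  · have h4 : ‖(WithLp.toLp 2 y : EuclideanSpace ℝ (Fin r))‖ ≤
        ‖(WithLp.toLp 2 ((T * T - 1) *ᵥ x) : EuclideanSpace ℝ (Fin r))‖ := by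
      refine le_of_mul_le_mul_left ?_ h0
      rw [← sq]
      exact h1.trans h2
    exact h4.trans h3

/-- The Procrustes alignment `R` makes `Uᵀ Uhat R` close to the identity. -/
lemma IsProcrustes.norm_sub_one_le {Uhat U : Matrix (Fin n) (Fin r) ℝ}
    {R : Matrix (Fin r) (Fin r) ℝ} (h : IsProcrustes Uhat U R) (hUhat : Uhatᵀ * Uhat = 1) :
    ‖Uᵀ * Uhat * R - 1‖ ≤ ‖Uᵀ * Uhat * (Uᵀ * Uhat)ᵀ - 1‖ := by
  have hT : ∀ P : Matrix (Fin r) (Fin r) ℝ, Pᵀ * P = 1 →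
      (Uᵀ * Uhat * R * P).trace ≤ (Uᵀ * Uhat * R).trace := by
    intro P hP
    rw [Matrix.mul_assoc]
    refine h.trace_le hUhat ?_
    rw [Matrix.transpose_mul, Matrix.mul_assoc, ← Matrix.mul_assoc Rᵀ, h.1, Matrix.one_mul, hP]
  have hsymm := transpose_eq_of_trace_le hT
  have hR : R * Rᵀ = 1 := mul_eq_one_comm.1 h.1
  have e : Uᵀ * Uhat * R * (Uᵀ * Uhat * R) = Uᵀ * Uhat * (Uᵀ * Uhat)ᵀ := by
    conv_lhs => rw [← hsymm]
    conv_lhs => lhs; rw [hsymm]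
    rw [Matrix.transpose_mul, Matrix.mul_assoc (Uᵀ * Uhat), ← Matrix.mul_assoc R, hR,
      Matrix.one_mul]
  rw [← e]
  exact norm_sub_one_le_of_psd (quadForm_nonneg_of_trace_le hT)

end Procrustes

/-! ### Deterministic perturbation theory of the top eigenspace -/

section Perturbation

variable {n r : ℕ}

/-- Weyl's inequality for the highest `r` eigenvalues of a perturbation of `U diag(v) Uᵀ`. -/
lemma sub_norm_le_top_eigenvalue {U : Matrix (Fin n) (Fin r) ℝ} (hU : Uᵀ * U = 1)
    {v : Fin r → ℝ} {s : ℝ} (hv : ∀ k, s ≤ v k) {E Q : Matrix (Fin n) (Fin n) ℝ} {d : Fin n → ℝ}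
    {f : Fin r ↪ Fin n} (hQ : Qᵀ * Q = 1)
    (hZ : U * Matrix.diagonal v * Uᵀ + E = Q * Matrix.diagonal d * Qᵀ)
    (hf : ∀ k l, l ∉ Set.range f → d l ≤ d (f k)) (k : Fin r) : s - ‖E‖ ≤ d (f k) := by
  -- Zeroing row `k` makes this square matrix singular. A kernel vector gives an `x` in the range of
  -- `U` orthogonal to all selected eigenvectors but the `k`-th, so the quadratic form of `Z` at `x`
  -- is at most `d (f k)` times `x ⬝ᵥ x`.
  set G : Matrix (Fin r) (Fin r) ℝ := ((Qᵀ * U).submatrix f id).updateRow k 0 with hG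
  have hdet : G.det = 0 := Matrix.det_eq_zero_of_row_eq_zero k fun j => by simp [hG]
  obtain ⟨c, hc, hGc⟩ := Matrix.exists_mulVec_eq_zero_iff.2 hdet
  set x := U *ᵥ c with hx
  set z := Qᵀ *ᵥ x with hz
  have hzf : ∀ k', k' ≠ k → z (f k') = 0 := by
    intro k' hk'
    have h := congrFun hGc k'
    simp only [Matrix.mulVec, hG, Matrix.updateRow_ne hk', Pi.zero_apply] at h
    rw [hz, hx, Matrix.mulVec_mulVec]
    exact h
  have hQ' : Q * Qᵀ = 1 := mul_eq_one_comm.1 hQ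
  have hxx : x ⬝ᵥ x = c ⬝ᵥ c := by
    rw [hx, Matrix.dotProduct_mulVec, ← Matrix.mulVec_transpose, Matrix.mulVec_mulVec, hU,
      Matrix.one_mulVec]
  have hzz : z ⬝ᵥ z = x ⬝ᵥ x := by
    rw [hz, Matrix.dotProduct_mulVec, ← Matrix.mulVec_transpose, Matrix.transpose_transpose,
      Matrix.mulVec_mulVec, hQ', Matrix.one_mulVec]
  have hcc : 0 < c ⬝ᵥ c := by
    rw [← norm_toLp_sq]
    have : (WithLp.toLp 2 c : EuclideanSpace ℝ (Fin r)) ≠ 0 := by simpa using hc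
    positivity
  have hquadZ : x ⬝ᵥ ((Q * Matrix.diagonal d * Qᵀ) *ᵥ x) = ∑ l, d l * z l ^ 2 := by
    rw [Matrix.mul_assoc, ← Matrix.mulVec_mulVec, Matrix.dotProduct_mulVec,
      ← Matrix.mulVec_transpose, ← hz, ← Matrix.mulVec_mulVec, ← hz, dotProduct]
    refine Finset.sum_congr rfl fun l _ => ?_
    rw [Matrix.mulVec_diagonal]
    ring
  have hquadM : x ⬝ᵥ ((U * Matrix.diagonal v * Uᵀ) *ᵥ x) = ∑ l, v l * c l ^ 2 := by
    have hc' : Uᵀ *ᵥ x = c := by rw [hx, Matrix.mulVec_mulVec, hU, Matrix.one_mulVec]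
    rw [Matrix.mul_assoc, ← Matrix.mulVec_mulVec, Matrix.dotProduct_mulVec,
      ← Matrix.mulVec_transpose, ← Matrix.mulVec_mulVec, hc', dotProduct]
    refine Finset.sum_congr rfl fun l _ => ?_
    rw [Matrix.mulVec_diagonal]
    ring
  have h1 : ∑ l, d l * z l ^ 2 ≤ d (f k) * (x ⬝ᵥ x) := by
    rw [← hzz, dotProduct, Finset.mul_sum]
    refine Finset.sum_le_sum fun l _ => ?_
    rw [← sq]
    by_cases hl : l ∈ Set.range f
    · obtain ⟨k', rfl⟩ := hl
      rcases eq_or_ne k' k with rfl | hk'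
      · exact le_rfl
      · simp [hzf k' hk']
    · exact mul_le_mul_of_nonneg_right (hf k l hl) (sq_nonneg _)
  have h2 : s * (x ⬝ᵥ x) ≤ ∑ l, v l * c l ^ 2 := by
    rw [hxx, dotProduct, Finset.mul_sum]
    refine Finset.sum_le_sum fun l _ => ?_
    rw [← sq]
    exact mul_le_mul_of_nonneg_right (hv l) (sq_nonneg _)
  have h3 := (abs_le.1 (abs_quadForm_le E x)).1
  have h4 : ∑ l, v l * c l ^ 2 + x ⬝ᵥ (E *ᵥ x) = ∑ l, d l * z l ^ 2 := by
    rw [← hquadM, ← hquadZ, ← hZ, Matrix.add_mulVec, dotProduct_add]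
  rw [← hxx] at hcc
  refine le_of_mul_le_mul_right ?_ hcc
  linarith

/-- The columns of `Y` span an invariant subspace of `U diag(v) Uᵀ + E` and `Uᵀ Y = 1`. -/
structure IsInvariantGraph (U : Matrix (Fin n) (Fin r) ℝ) (v : Fin r → ℝ)
    (E : Matrix (Fin n) (Fin n) ℝ) (Y : Matrix (Fin n) (Fin r) ℝ) : Prop where
  normalized : Uᵀ * Y = 1
  eq : (Y - U) * Matrix.diagonal v = E * Y - Y * (Uᵀ * (E * Y))

lemma norm_le_one_add {U Y : Matrix (Fin n) (Fin r) ℝ} (hU : Uᵀ * U = 1) :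
    ‖Y‖ ≤ 1 + ‖Y - U‖ := by
  have h := norm_add_le U (Y - U)
  rw [add_sub_cancel] at h
  linarith [orthogonal_norm_le_one hU]

/-- Davis-Kahan: the highest `r` eigenvectors of a small perturbation of `U diag(v) Uᵀ` span a
graph over the range of `U` with small slope. -/
lemma IsTopEigenvectors.exists_isInvariantGraph {U : Matrix (Fin n) (Fin r) ℝ} (hU : Uᵀ * U = 1)
    {v : Fin r → ℝ} {s : ℝ} (hs : 0 < s) (hv : ∀ k, s ≤ v k) {E : Matrix (Fin n) (Fin n) ℝ}
    {ε : ℝ} (hε : ε ≤ 1 / 8) (hE : ‖E‖ ≤ ε * s) {Uhat : Matrix (Fin n) (Fin r) ℝ}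
    (h : IsTopEigenvectors (U * Matrix.diagonal v * Uᵀ + E) Uhat) :
    Uhatᵀ * Uhat = 1 ∧ ∃ Y, IsInvariantGraph U v E Y ∧ ‖Y - U‖ ≤ 4 * ε ∧
      Uhat = Y * (Uᵀ * Uhat) := by
  obtain ⟨Q, d, f, hQ, hZ, hf, rfl⟩ := h
  have hε0 : 0 ≤ ε := by
    by_contra hneg
    nlinarith [norm_nonneg E]
  set W := Q.submatrix id f with hW
  set M := U * Matrix.diagonal v * Uᵀ with hM
  have hWW : Wᵀ * W = 1 := by
    ext i j
    have h := congrFun (congrFun hQ (f i)) (f j)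
    rw [Matrix.mul_apply] at h ⊢
    simpa [hW, Matrix.one_apply] using h
  have hZW : (M + E) * W = W * Matrix.diagonal (d ∘ f) := by
    have h1 : (M + E) * Q = Q * Matrix.diagonal d := by
      rw [hZ, Matrix.mul_assoc, hQ, Matrix.mul_one]
    ext i j
    have h2 := congrFun (congrFun h1 i) (f j)
    rw [Matrix.mul_diagonal, Matrix.mul_apply] at h2
    rw [Matrix.mul_diagonal, Matrix.mul_apply]
    exact h2
  have hWn : ‖W‖ ≤ 1 := orthogonal_norm_le_one hWW
  have hUn : ‖U‖ ≤ 1 := orthogonal_norm_le_one hU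
  have hUt : ‖Uᵀ‖ ≤ 1 := (norm_transpose U).trans_le hUn
  have hlam : ∀ k, s - ‖E‖ ≤ (d ∘ f) k := sub_norm_le_top_eigenvalue hU hv hQ hZ hf
  set H := Uᵀ * W with hH
  set N := W - U * H with hN
  have hHn : ‖H‖ ≤ 1 := (Matrix.l2_opNorm_mul _ _).trans (by nlinarith [norm_nonneg W])
  have hUtM : Uᵀ * M = Matrix.diagonal v * Uᵀ := by
    rw [hM, ← Matrix.mul_assoc, ← Matrix.mul_assoc, hU, Matrix.one_mul]
  have hUtN : Uᵀ * N = 0 := by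
    rw [hN, Matrix.mul_sub, ← Matrix.mul_assoc, hU, Matrix.one_mul, ← hH, sub_self]
  -- The eigenvector equation projected off the range of `U`: the signal drops out, and the selected
  -- eigenvalues, at least `7 s / 8`, can be divided out.
  have hNeq : N * Matrix.diagonal (d ∘ f) = E * W - U * (Uᵀ * (E * W)) := by
    rw [hN, hH, Matrix.sub_mul, ← hZW, Matrix.mul_assoc U, Matrix.mul_assoc Uᵀ, ← hZW,
      Matrix.add_mul, Matrix.mul_add Uᵀ, ← Matrix.mul_assoc Uᵀ M, hUtM, Matrix.mul_add U]
    rw [hM]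
    simp only [Matrix.mul_assoc]
    abel
  have hEW : ‖E * W‖ ≤ ε * s :=
    (Matrix.l2_opNorm_mul _ _).trans (by nlinarith [norm_nonneg E, norm_nonneg W])
  have hUE : ‖U * (Uᵀ * (E * W))‖ ≤ ε * s := by
    have h1 := Matrix.l2_opNorm_mul U (Uᵀ * (E * W))
    have h2 := Matrix.l2_opNorm_mul Uᵀ (E * W)
    nlinarith [norm_nonneg U, norm_nonneg (E * W), norm_nonneg (Uᵀ * (E * W))]
  have hsE : 7 / 8 * s ≤ s - ‖E‖ := by nlinarith
  have hNn : ‖N‖ ≤ 16 / 7 * ε := by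
    have h1 := norm_le_of_mul_diagonal N (by positivity : 0 < 7 / 8 * s)
      (fun k => hsE.trans (hlam k))
    rw [hNeq] at h1
    have h2 := h1.trans ((norm_sub_le _ _).trans (add_le_add hEW hUE))
    refine le_of_mul_le_mul_left ?_ hs
    linarith
  -- Pythagoras for `W = U * H + N`. As `N` is small, `H` is invertible, and `W * H⁻¹` is the
  -- normalized basis.
  have hHH : Hᵀ * H = 1 - Nᵀ * N := by
    have h1 : W = U * H + N := by rw [hN]; abel
    have hNU : Nᵀ * U = 0 := by
      rw [← Matrix.transpose_transpose (Nᵀ * U), Matrix.transpose_mul, Matrix.transpose_transpose,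
        hUtN, Matrix.transpose_zero]
    have h2 : Wᵀ * W = Hᵀ * H + Nᵀ * N := by
      conv_lhs => rw [h1]
      rw [Matrix.transpose_add, Matrix.transpose_mul, Matrix.add_mul, Matrix.mul_add,
        Matrix.mul_add, Matrix.mul_assoc Hᵀ, ← Matrix.mul_assoc Uᵀ, hU, Matrix.one_mul,
        Matrix.mul_assoc Hᵀ, hUtN, Matrix.mul_zero, ← Matrix.mul_assoc Nᵀ, hNU, Matrix.zero_mul]
      abel
    rw [← hWW, h2]
    abel
  have hNN : ‖Nᵀ * N‖ ≤ 1 / 10 := by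
    refine (Matrix.l2_opNorm_mul _ _).trans ?_
    rw [norm_transpose]
    nlinarith [norm_nonneg N]
  have hunit : IsUnit (Hᵀ * H).det := by
    rw [← Matrix.isUnit_iff_isUnit_det, hHH]
    exact isUnit_one_sub_of_norm_lt_one (by linarith)
  have hdet : IsUnit H.det := by
    rw [Matrix.det_mul] at hunit
    exact isUnit_of_mul_isUnit_right hunit
  set K := H⁻¹ with hK
  have hHK : H * K = 1 := Matrix.mul_nonsing_inv H hdet
  have hKH : K * H = 1 := Matrix.nonsing_inv_mul H hdet
  have hKn : ‖K‖ ≤ 10 / 9 := by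
    have h1 : K = Hᵀ + Nᵀ * N * K := by
      have h2 : Hᵀ * H * K = Hᵀ := by rw [Matrix.mul_assoc, hHK, Matrix.mul_one]
      rw [hHH, Matrix.sub_mul, Matrix.one_mul] at h2
      rw [← h2]
      abel
    have h3 : ‖K‖ ≤ ‖Hᵀ‖ + ‖Nᵀ * N‖ * ‖K‖ := by
      conv_lhs => rw [h1]
      exact (norm_add_le _ _).trans (add_le_add le_rfl (Matrix.l2_opNorm_mul _ _))
    rw [norm_transpose] at h3
    nlinarith [norm_nonneg K]
  have hYU : W * K - U = N * K := by
    rw [hN, Matrix.sub_mul, Matrix.mul_assoc U, hHK, Matrix.mul_one]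
  have hEWK : (M + E) * (W * K) = W * K * (H * Matrix.diagonal (d ∘ f) * K) := by
    calc (M + E) * (W * K) = W * Matrix.diagonal (d ∘ f) * K := by rw [← Matrix.mul_assoc, hZW]
      _ = W * (K * H) * Matrix.diagonal (d ∘ f) * K := by rw [hKH, Matrix.mul_one]
      _ = _ := by simp only [Matrix.mul_assoc]
  have hnorm : Uᵀ * (W * K) = 1 := by rw [← Matrix.mul_assoc, ← hH, hHK]
  refine ⟨hWW, W * K, ⟨hnorm, ?_⟩, ?_, ?_⟩
  · set Y := W * K with hY
    set Λ := H * Matrix.diagonal (d ∘ f) * K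
    have h1 : Λ = Matrix.diagonal v + Uᵀ * (E * Y) := by
      calc Λ = Uᵀ * (Y * Λ) := by rw [← Matrix.mul_assoc, hnorm, Matrix.one_mul]
        _ = _ := by
          rw [← hEWK, Matrix.add_mul, Matrix.mul_add, ← Matrix.mul_assoc Uᵀ M, hUtM,
            Matrix.mul_assoc, hnorm, Matrix.mul_one]
    have h2 : M * Y = U * Matrix.diagonal v := by
      rw [hM, Matrix.mul_assoc, hnorm, Matrix.mul_one]
    rw [h1, Matrix.add_mul, h2, Matrix.mul_add] at hEWK
    rw [Matrix.sub_mul, sub_eq_sub_iff_add_eq_add, ← hEWK]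
    abel
  · rw [hYU]
    refine (Matrix.l2_opNorm_mul _ _).trans ?_
    nlinarith [norm_nonneg N, norm_nonneg K]
  · rw [Matrix.mul_assoc, hKH, Matrix.mul_one]

/-- Aligned eigenvectors are close to `U` as soon as the normalized basis `Y` is. -/
lemma IsInvariantGraph.aligned_sub_eq {U Y Uhat : Matrix (Fin n) (Fin r) ℝ} {v : Fin r → ℝ}
    {E : Matrix (Fin n) (Fin n) ℝ} (hU : Uᵀ * U = 1) (hY : IsInvariantGraph U v E Y)
    (hUhat : Uhatᵀ * Uhat = 1) (hYU : Uhat = Y * (Uᵀ * Uhat)) {R : Matrix (Fin r) (Fin r) ℝ}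
    (hR : IsProcrustes Uhat U R) :
    ∃ T : Matrix (Fin r) (Fin r) ℝ, ‖T‖ ≤ ‖Y - U‖ ^ 2 ∧
      Uhat * R - U = (Y - U) + Y * T := by
  set H := Uᵀ * Uhat with hH
  refine ⟨H * R - 1, ?_, ?_⟩
  · refine (hR.norm_sub_one_le hUhat).trans ?_
    rw [← hH]
    set D := Y - U with hD
    have hUD : Uᵀ * D = 0 := by rw [hD, Matrix.mul_sub, hY.normalized, hU, sub_self]
    have hDU : Dᵀ * U = 0 := by
      rw [← Matrix.transpose_transpose (Dᵀ * U), Matrix.transpose_mul, Matrix.transpose_transpose,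
        hUD, Matrix.transpose_zero]
    have hYY : Yᵀ * Y = 1 + Dᵀ * D := by
      have h1 : Y = U + D := by rw [hD]; abel
      rw [h1, Matrix.transpose_add, Matrix.add_mul, Matrix.mul_add, Matrix.mul_add, hU, hUD, hDU]
      abel
    have h1 : Hᵀ * (Yᵀ * Y) * H = 1 := by
      have h := hUhat
      rw [hYU, Matrix.transpose_mul] at h
      rw [← h]
      simp only [Matrix.mul_assoc]
    have h2 : H * Hᵀ * (1 + Dᵀ * D) = 1 := by
      rw [← hYY, Matrix.mul_assoc]
      exact mul_eq_one_comm.1 h1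
    have h3 : H * Hᵀ - 1 = -(H * Hᵀ * (Dᵀ * D)) := by
      rw [Matrix.mul_add, Matrix.mul_one] at h2
      rw [← h2]
      abel
    have hHn : ‖H‖ ≤ 1 := by
      have h4 := Matrix.l2_opNorm_mul Uᵀ Uhat
      rw [norm_transpose] at h4
      have := orthogonal_norm_le_one hU
      have := orthogonal_norm_le_one hUhat
      rw [← hH] at h4
      nlinarith [norm_nonneg U, norm_nonneg Uhat]
    have h5 : ‖H * Hᵀ‖ ≤ 1 := by
      refine (Matrix.l2_opNorm_mul _ _).trans ?_
      rw [norm_transpose]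
      nlinarith [norm_nonneg H]
    have h6 : ‖Dᵀ * D‖ ≤ ‖D‖ ^ 2 := by
      refine (Matrix.l2_opNorm_mul _ _).trans ?_
      rw [norm_transpose, sq]
    rw [h3, norm_neg]
    refine (Matrix.l2_opNorm_mul _ _).trans ?_
    nlinarith [norm_nonneg (H * Hᵀ), norm_nonneg (Dᵀ * D)]
  · rw [Matrix.mul_sub, Matrix.mul_one, ← Matrix.mul_assoc, ← hYU]
    abel

/-- Needed for the leave-one-out matrices, where no eigenvectors are given. Sorting `-d`
increasingly puts the highest eigenvalues first. -/
lemma exists_isTopEigenvectors {Z : Matrix (Fin n) (Fin n) ℝ} (hZ : Zᵀ = Z) (hrn : r ≤ n) :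
    ∃ Uhat : Matrix (Fin n) (Fin r) ℝ, IsTopEigenvectors Z Uhat := by
  obtain ⟨Q, d, hQ, -, hZd⟩ := exists_eigendecomposition hZ
  set e := Tuple.sort (fun i => -d i) with he
  have hmono : Monotone ((fun i => -d i) ∘ e) := Tuple.monotone_sort _
  refine ⟨_, Q, d, (Fin.castLEEmb hrn).trans e.toEmbedding, hQ, hZd, fun k l hl => ?_, rfl⟩
  have hle : Fin.castLE hrn k ≤ e.symm l := by
    by_contra hlt
    rw [not_le, Fin.lt_def] at hlt
    refine hl ⟨⟨e.symm l, ?_⟩, ?_⟩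
    · have := k.2
      simp at hlt
      omega
    · simp [Fin.castLE]
  have := hmono hle
  simpa using this

/-- Leave-one-out comparison of two invariant graphs. -/
lemma IsInvariantGraph.norm_basis_sub_le {U Y Y' : Matrix (Fin n) (Fin r) ℝ} {v : Fin r → ℝ} {s : ℝ}
    (hU : Uᵀ * U = 1) (hs : 0 < s) (hv : ∀ k, s ≤ v k) {E E' : Matrix (Fin n) (Fin n) ℝ}
    {ε : ℝ} (hε : ε ≤ 1 / 100) (hE : ‖E‖ ≤ ε * s)
    (hY : IsInvariantGraph U v E Y) (hY' : IsInvariantGraph U v E' Y')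
    (hYn : ‖Y‖ ≤ 11 / 10) (hYn' : ‖Y'‖ ≤ 11 / 10) :
    s * ‖Y - Y'‖ ≤ 3 * ‖(E - E') * Y'‖ := by
  have hε0 : 0 ≤ ε := by
    by_contra hneg
    nlinarith [norm_nonneg E]
  have hUn := orthogonal_norm_le_one hU
  have hUt : ‖Uᵀ‖ ≤ 1 := (norm_transpose U).trans_le hUn
  set Δ := Y - Y' with hΔ
  set F := (E - E') * Y' with hF
  set G := E * Δ + F with hG
  have hGeq : E * Y - E' * Y' = G := by
    rw [hG, hF, hΔ, Matrix.mul_sub, Matrix.sub_mul]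
    abel
  -- The difference of the two quadratic equations. On the right, the terms containing `Δ` carry a
  -- factor of size `ε s` and are absorbed into the left side.
  have h1 : Δ * Matrix.diagonal v = G - (Δ * (Uᵀ * (E * Y)) + Y' * (Uᵀ * G)) := by
    have e1 : Δ * Matrix.diagonal v =
        (Y - U) * Matrix.diagonal v - (Y' - U) * Matrix.diagonal v := by
      rw [← Matrix.sub_mul]
      congr 1
      rw [hΔ]
      abel
    rw [e1, hY.eq, hY'.eq, ← hGeq, hΔ]
    simp only [Matrix.mul_sub, Matrix.sub_mul]
    abel
  have h2 := norm_le_of_mul_diagonal Δ hs hv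
  have hGn : ‖G‖ ≤ ε * s * ‖Δ‖ + ‖F‖ := by
    refine (norm_add_le _ _).trans (add_le_add ((Matrix.l2_opNorm_mul _ _).trans ?_) le_rfl)
    gcongr
  have hEY : ‖Uᵀ * (E * Y)‖ ≤ ε * s * (11 / 10) := by
    refine (Matrix.l2_opNorm_mul _ _).trans ?_
    have : ‖E * Y‖ ≤ ε * s * (11 / 10) := (Matrix.l2_opNorm_mul _ _).trans (by gcongr)
    nlinarith [norm_nonneg (E * Y)]
  have hUG : ‖Uᵀ * G‖ ≤ ‖G‖ := by
    refine (Matrix.l2_opNorm_mul _ _).trans ?_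
    nlinarith [norm_nonneg G]
  have hA : ‖Δ * (Uᵀ * (E * Y))‖ ≤ ‖Δ‖ * (ε * s * (11 / 10)) :=
    (Matrix.l2_opNorm_mul _ _).trans (by gcongr)
  have hB : ‖Y' * (Uᵀ * G)‖ ≤ 11 / 10 * ‖G‖ :=
    (Matrix.l2_opNorm_mul _ _).trans (by gcongr)
  have h3 : ‖Δ * Matrix.diagonal v‖ ≤ ‖G‖ + (‖Δ‖ * (ε * s * (11 / 10)) + 11 / 10 * ‖G‖) := by
    rw [h1]
    exact (norm_sub_le _ _).trans
      (add_le_add le_rfl ((norm_add_le _ _).trans (add_le_add hA hB)))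
  have h4 : ε * s * ‖Δ‖ ≤ 1 / 100 * (s * ‖Δ‖) := by
    rw [mul_assoc]
    exact mul_le_mul_of_nonneg_right hε (by positivity)
  linarith [norm_nonneg F, norm_nonneg Δ]

/-- The diagonal projection that kills the coordinate `k`. -/
def coordProj (k : Fin n) : Matrix (Fin n) (Fin n) ℝ := 1 - Matrix.diagonal (Pi.single k 1)

lemma norm_coordProj_le (k : Fin n) : ‖coordProj k‖ ≤ 1 := by
  have h : coordProj k = Matrix.diagonal (fun i => if i = k then (0 : ℝ) else 1) := by
    rw [coordProj, ← Matrix.diagonal_one, Matrix.diagonal_sub]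
    congr 1
    ext i
    by_cases hi : i = k <;> simp [hi]
  rw [h]
  refine norm_diagonal_le zero_le_one fun i => ?_
  split_ifs <;> simp

lemma norm_coordProj_conj_le (E : Matrix (Fin n) (Fin n) ℝ) (k : Fin n) :
    ‖coordProj k * E * coordProj k‖ ≤ ‖E‖ := by
  have h1 := Matrix.l2_opNorm_mul (coordProj k * E) (coordProj k)
  have h2 := Matrix.l2_opNorm_mul (coordProj k) E
  have h3 := norm_coordProj_le k
  nlinarith [norm_nonneg E, norm_nonneg (coordProj k), norm_nonneg (coordProj k * E)]

/-- With `J` the projection onto coordinate `k` and `P = 1 - J`, the removed part is `E - P E P = J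
E + P E J`. The first term sees only row `k` of `E * Y`, the second only row `k` of `Y`. -/
lemma norm_sub_coordProj_conj_mul_le (E : Matrix (Fin n) (Fin n) ℝ) (k : Fin n)
    (Y : Matrix (Fin n) (Fin r) ℝ) :
    ‖(E - coordProj k * E * coordProj k) * Y‖ ≤ ‖matRow (E * Y) k‖ + ‖E‖ * ‖matRow Y k‖ := by
  set J : Matrix (Fin n) (Fin n) ℝ := Matrix.diagonal (Pi.single k 1) with hJ
  have h1 : (E - coordProj k * E * coordProj k) * Y =
      J * (E * Y) + coordProj k * (E * (J * Y)) := by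
    simp only [coordProj, ← hJ, Matrix.sub_mul, Matrix.mul_sub, Matrix.one_mul, Matrix.mul_one,
      Matrix.mul_assoc]
    abel
  rw [h1]
  refine (norm_add_le _ _).trans (add_le_add (norm_diagonal_single_mul_le k _) ?_)
  have h2 := Matrix.l2_opNorm_mul (coordProj k) (E * (J * Y))
  have h3 := Matrix.l2_opNorm_mul E (J * Y)
  have h4 := norm_diagonal_single_mul_le k Y
  have h5 := norm_coordProj_le k
  have h6 : ‖E‖ * ‖J * Y‖ ≤ ‖E‖ * ‖matRow Y k‖ := by gcongr
  nlinarith [norm_nonneg (E * (J * Y))]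

/-- Leave-one-out analysis: the rows of the normalized basis `Y` of the perturbed invariant
subspace are close to those of `U` if the `k`-th row of the perturbation acts as expected on the
basis that belongs to the perturbation without its `k`-th row and column. -/
lemma IsInvariantGraph.twoInfNorm_sub_le {U Y : Matrix (Fin n) (Fin r) ℝ} {v : Fin r → ℝ} {s : ℝ}
    (hU : Uᵀ * U = 1) (hs : 0 < s) (hv : ∀ k, s ≤ v k) {E : Matrix (Fin n) (Fin n) ℝ}
    {ε : ℝ} (hε : ε ≤ 1 / 100) (hE : ‖E‖ ≤ ε * s)
    (hY : IsInvariantGraph U v E Y) (hYn : ‖Y - U‖ ≤ 4 * ε)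
    (hloo : ∀ k, ∃ Y', IsInvariantGraph U v (coordProj k * E * coordProj k) Y' ∧
      ‖Y' - U‖ ≤ 4 * ε ∧ ‖matRow (E * Y') k‖ ≤ ε * s * twoInfNorm Y') :
    twoInfNorm (Y - U) ≤ 10 * ε * twoInfNorm U := by
  have hε0 : 0 ≤ ε := by
    by_contra hneg
    nlinarith [norm_nonneg E]
  have hY1 : ‖Y‖ ≤ 11 / 10 := (norm_le_one_add hU).trans (by linarith)
  have hUt : ‖Uᵀ‖ ≤ 1 := (norm_transpose U).trans_le (orthogonal_norm_le_one hU)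
  have hrow : ∀ k, ‖matRow (Y - U) k‖ ≤ 5 * ε * twoInfNorm Y := by
    intro k
    obtain ⟨Y', hY', hYn', hk⟩ := hloo k
    have hY1' : ‖Y'‖ ≤ 11 / 10 := (norm_le_one_add hU).trans (by linarith)
    have h1 := hY.norm_basis_sub_le hU hs hv hε hE hY' hY1 hY1'
    have h2 := norm_sub_coordProj_conj_mul_le E k Y'
    have h3 : ‖E‖ * ‖matRow Y' k‖ ≤ ε * s * twoInfNorm Y' :=
      mul_le_mul hE (norm_matRow_le_twoInfNorm _ _) (norm_nonneg _) (by positivity)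
    have hΔ : ‖Y - Y'‖ ≤ 6 * ε * twoInfNorm Y' := by
      refine le_of_mul_le_mul_left ?_ hs
      linarith
    have h4 : twoInfNorm Y' ≤ twoInfNorm Y + ‖Y - Y'‖ :=
      twoInfNorm_le (add_nonneg (twoInfNorm_nonneg _) (norm_nonneg _)) fun i => by
        have e : matRow Y' i = matRow Y i - matRow (Y - Y') i := by rw [matRow_sub]; abel
        rw [e]
        exact (norm_sub_le _ _).trans
          (add_le_add (norm_matRow_le_twoInfNorm _ _) (norm_matRow_le_norm _ _))
    have hτ := twoInfNorm_nonneg Y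
    have hτ' := twoInfNorm_nonneg Y'
    have h5 : ε * twoInfNorm Y' ≤ 1 / 100 * twoInfNorm Y' := by gcongr
    -- Self-bounding: `Y` and `Y'` differ by at most `6 / 100` of the row norm of `Y'`, so their row
    -- norms are comparable.
    have h6 : twoInfNorm Y' ≤ 11 / 10 * twoInfNorm Y := by linarith
    have h7 : ‖matRow (E * Y) k‖ ≤ 2 * (ε * s * twoInfNorm Y) := by
      have e : E * Y = E * Y' + E * (Y - Y') := by rw [← Matrix.mul_add]; congr 1; abel
      rw [e, matRow_add]
      have h8 : ‖matRow (E * (Y - Y')) k‖ ≤ ε * s * (6 * ε * twoInfNorm Y') :=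
        (norm_matRow_le_norm _ _).trans ((Matrix.l2_opNorm_mul _ _).trans
          (mul_le_mul hE hΔ (norm_nonneg _) (by positivity)))
      have h9 : ε * s * (6 * ε * twoInfNorm Y') ≤ ε * s * (6 / 100 * twoInfNorm Y') := by
        refine mul_le_mul_of_nonneg_left ?_ (by positivity)
        linarith
      have h10 : ε * s * twoInfNorm Y' ≤ ε * s * (11 / 10 * twoInfNorm Y) := by gcongr
      have h11 : 0 ≤ ε * s * twoInfNorm Y := by positivity
      have := norm_add_le (matRow (E * Y') k) (matRow (E * (Y - Y')) k)
      linarith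
    -- Row `k` of the quadratic equation for `Y` converts the bound on row `k` of `E * Y` into one
    -- on row `k` of `Y - U`.
    have h12 := norm_matRow_le_of_mul_diagonal (Y - U) hs hv k
    rw [hY.eq, matRow_sub (E * Y)] at h12
    have h13 : ‖Uᵀ * (E * Y)‖ ≤ ε * s * (11 / 10) := by
      refine (Matrix.l2_opNorm_mul _ _).trans ?_
      have : ‖E * Y‖ ≤ ε * s * (11 / 10) := (Matrix.l2_opNorm_mul _ _).trans (by gcongr)
      nlinarith [norm_nonneg (E * Y)]
    have h14 : ‖matRow (Y * (Uᵀ * (E * Y))) k‖ ≤ twoInfNorm Y * (ε * s * (11 / 10)) :=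
      (norm_matRow_mul_le _ _ _).trans
        (mul_le_mul (norm_matRow_le_twoInfNorm _ _) h13 (norm_nonneg _) hτ)
    have h15 := norm_sub_le (matRow (E * Y) k) (matRow (Y * (Uᵀ * (E * Y))) k)
    have h16 : 0 ≤ ε * s * twoInfNorm Y := by positivity
    refine le_of_mul_le_mul_left ?_ hs
    linarith
  have hD := twoInfNorm_le (by have := twoInfNorm_nonneg Y; positivity) hrow
  have hYle : twoInfNorm Y ≤ twoInfNorm U + twoInfNorm (Y - U) := by
    have h := twoInfNorm_add_le U (Y - U)
    rwa [add_sub_cancel] at h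
  have h5 : ε * twoInfNorm Y ≤ 1 / 100 * twoInfNorm Y :=
    mul_le_mul_of_nonneg_right hε (twoInfNorm_nonneg Y)
  have h6 : twoInfNorm Y ≤ 2 * twoInfNorm U := by linarith [twoInfNorm_nonneg Y]
  have h7 : ε * twoInfNorm Y ≤ ε * (2 * twoInfNorm U) := by gcongr
  linarith

end Perturbation

/-! ### From the abstract probability space to finite coin tosses -/

section Transfer

open Classical in
/-- The outcomes of the coin tosses that decide which of the events `s w` occur. -/
def occurs {ι Ω : Type*} (s : ι → Set Ω) (ω : Ω) (w : ι) : Bool := decide (ω ∈ s w)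

lemma prob_occurs_eq {ι Ω : Type*} [Fintype ι] [MeasurableSpace Ω] (P : Measure Ω)
    [IsProbabilityMeasure P] {p : ℝ} (hp : 0 ≤ p) {s : ι → Set Ω}
    (hs : ∀ w, MeasurableSet (s w)) (hind : iIndepSet s P)
    (hprob : ∀ w, P (s w) = ENNReal.ofReal p) (b : ι → Bool) :
    MeasurableSet {ω | occurs s ω = b} ∧ P.real {ω | occurs s ω = b} = bernWeight p b := by
  set t : ι → Set Ω := fun w => if b w then s w else (s w)ᶜ with ht
  have htm : ∀ w, MeasurableSet (t w) := fun w => by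
    simp only [ht]
    split_ifs
    exacts [hs w, (hs w).compl]
  have e : {ω | occurs s ω = b} = ⋂ w, t w := by
    ext ω
    simp only [Set.mem_ofPred_eq, Set.mem_iInter, funext_iff]
    refine forall_congr' fun w => ?_
    simp only [occurs, ht]
    cases hb : b w <;> simp
  refine ⟨e ▸ MeasurableSet.iInter htm, ?_⟩
  -- Independence of the generated σ-algebras covers complements, so the product formula holds for
  -- every pattern of successes and failures.
  have h1 := ((iIndepSet_iff_iIndep s P).1 hind).meas_iInter (s := t) fun w => by
    have hw : MeasurableSet[MeasurableSpace.generateFrom {s w}] (s w) :=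
      MeasurableSpace.measurableSet_generateFrom rfl
    simp only [ht]
    split_ifs
    exacts [hw, hw.compl]
  rw [e, measureReal_def, h1, ENNReal.toReal_prod]
  refine Finset.prod_congr rfl fun w _ => ?_
  have hw : P.real (s w) = p := by rw [measureReal_def, hprob, ENNReal.toReal_ofReal hp]
  simp only [ht]
  rw [← measureReal_def]
  split_ifs with hb
  · exact hw
  · rw [probReal_compl_eq_one_sub (hs w), hw]

lemma prob_occurs_mem_eq {ι Ω : Type*} [Fintype ι] [DecidableEq ι] [MeasurableSpace Ω]
    (P : Measure Ω) [IsProbabilityMeasure P] {p : ℝ} (hp : 0 ≤ p) {s : ι → Set Ω}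
    (hs : ∀ w, MeasurableSet (s w)) (hind : iIndepSet s P)
    (hprob : ∀ w, P (s w) = ENNReal.ofReal p) (G : Set (ι → Bool)) :
    P.real {ω | occurs s ω ∈ G} = bernP p G := by
  classical
  have e : {ω | occurs s ω ∈ G} = ⋃ b ∈ Finset.univ.filter (· ∈ G), {ω | occurs s ω = b} := by
    ext ω
    simp
  rw [e, measureReal_biUnion_finset]
  · rw [Finset.sum_congr rfl fun b _ => (prob_occurs_eq P hp hs hind hprob b).2, Finset.sum_filter,
      bernP, bernE]
    refine Finset.sum_congr rfl fun b _ => ?_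
    by_cases hb : b ∈ G <;> simp [hb]
  · intro b _ b' _ hbb'
    refine Set.disjoint_left.2 fun ω h1 h2 => hbb' ?_
    rw [← (show occurs s ω = b from h1), ← (show occurs s ω = b' from h2)]
  · exact fun b _ => (prob_occurs_eq P hp hs hind hprob b).1

end Transfer

/-! ### The wedge matrix as signal plus independent noise -/

section Wedges

variable {n m : ℕ}

/-- The wedge `w` joins `x` and `y`. -/
def Wedge.Joins (w : Wedge n m) (x y : Fin n) : Prop :=
  (w.1.1 = x ∧ w.1.2.2 = y) ∨ (w.1.1 = y ∧ w.1.2.2 = x)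

instance (w : Wedge n m) (x y : Fin n) : Decidable (w.Joins x y) := by
  unfold Wedge.Joins
  infer_instance

lemma Wedge.Joins.symm {w : Wedge n m} {x y : Fin n} (h : w.Joins x y) : w.Joins y x := Or.symm h

lemma Wedge.joins_comm {w : Wedge n m} {x y : Fin n} : w.Joins x y ↔ w.Joins y x :=
  ⟨Wedge.Joins.symm, Wedge.Joins.symm⟩

lemma Wedge.Joins.right_unique {w : Wedge n m} {x y z : Fin n} (h : w.Joins x y)
    (h' : w.Joins x z) : y = z := by
  rcases h with ⟨h1, h2⟩ | ⟨h1, h2⟩ <;> rcases h' with ⟨h3, h4⟩ | ⟨h3, h4⟩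
  · rw [← h2, h4]
  · rw [← h2, h4, ← h3, h1]
  · rw [← h1, h3, ← h4, h2]
  · rw [← h1, h3]

/-- The symmetric matrix with the entries of `A Aᵀ` that the wedge `w` contributes. -/
def wedgeBasis (A : Matrix (Fin n) (Fin m) ℝ) (w : Wedge n m) : Matrix (Fin n) (Fin n) ℝ :=
  Matrix.of fun x y => if w.Joins x y then A x w.1.2.1 * A y w.1.2.1 else 0

lemma wedgeBasis_apply (A : Matrix (Fin n) (Fin m) ℝ) (w : Wedge n m) (x y : Fin n) :
    wedgeBasis A w x y = if w.Joins x y then A x w.1.2.1 * A y w.1.2.1 else 0 := rfl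

lemma wedgeBasis_transpose (A : Matrix (Fin n) (Fin m) ℝ) (w : Wedge n m) :
    (wedgeBasis A w)ᵀ = wedgeBasis A w := by
  ext x y
  rw [Matrix.transpose_apply, wedgeBasis_apply, wedgeBasis_apply]
  simp only [Wedge.joins_comm (x := y), mul_comm]

/-- For each middle vertex exactly one wedge joins `x` and `y`, because a wedge stores its end
points in increasing order. -/
lemma sum_wedge_joins (x y : Fin n) (F : Fin m → ℝ) :
    ∑ w : Wedge n m, (if w.Joins x y then F w.1.2.1 else 0) = ∑ l, F l := by
  rw [← Finset.sum_filter]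
  refine Finset.sum_bij (fun w _ => w.1.2.1) (fun _ _ => Finset.mem_univ _) ?_ ?_ fun _ _ => rfl
  · rintro ⟨⟨i, l, j⟩, h⟩ hw ⟨⟨i', l', j'⟩, h'⟩ hw' hl
    replace hw : (i = x ∧ j = y) ∨ (i = y ∧ j = x) := (Finset.mem_filter.1 hw).2
    replace hw' : (i' = x ∧ j' = y) ∨ (i' = y ∧ j' = x) := (Finset.mem_filter.1 hw').2
    simp only at hl h h'
    subst hl
    have : i = i' ∧ j = j' := by
      rcases hw with ⟨rfl, rfl⟩ | ⟨rfl, rfl⟩ <;> rcases hw' with ⟨rfl, rfl⟩ | ⟨rfl, rfl⟩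
      · exact ⟨rfl, rfl⟩
      · exact ⟨le_antisymm h h', le_antisymm h' h⟩
      · exact ⟨le_antisymm h h', le_antisymm h' h⟩
      · exact ⟨rfl, rfl⟩
    simp [this.1, this.2]
  · intro l _
    rcases le_total x y with hxy | hxy
    · exact ⟨⟨(x, l, y), hxy⟩, Finset.mem_filter.2 ⟨Finset.mem_univ _, Or.inl ⟨rfl, rfl⟩⟩, rfl⟩
    · exact ⟨⟨(y, l, x), hxy⟩, Finset.mem_filter.2 ⟨Finset.mem_univ _, Or.inr ⟨rfl, rfl⟩⟩, rfl⟩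

lemma sum_wedgeBasis (A : Matrix (Fin n) (Fin m) ℝ) : ∑ w, wedgeBasis A w = A * Aᵀ := by
  ext x y
  rw [Matrix.sum_apply, Matrix.mul_apply]
  exact sum_wedge_joins x y fun l => A x l * A y l

lemma wedgeMatrix_eq_sum (A : Matrix (Fin n) (Fin m) ℝ) (p : ℝ) (b : Wedge n m → Bool) :
    wedgeMatrix A p {w | b w = true} = ∑ w, (if b w then p⁻¹ else 0) • wedgeBasis A w := by
  rw [wedgeMatrix, Finset.sum_filter, Finset.sum_filter, ← Finset.sum_add_distrib]
  refine Finset.sum_congr rfl fun w _ => ?_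
  obtain ⟨⟨i, l, j⟩, hij⟩ := w
  ext x y
  simp only [wedgeTerm, Set.mem_ofPred_eq, Matrix.smul_apply, wedgeBasis_apply, smul_eq_mul]
  have hJ : Wedge.Joins ⟨(i, l, j), hij⟩ x y ↔ (i = x ∧ j = y) ∨ (i = y ∧ j = x) := Iff.rfl
  rcases (show i ≤ j from hij).lt_or_eq with h | h
  · rw [if_pos h, if_neg h.ne, add_zero]
    simp only [Matrix.add_apply, Matrix.transpose_apply, Matrix.single_apply]
    by_cases h1 : i = x ∧ j = y
    · have h2 : ¬ (i = y ∧ j = x) := fun h2 => h.ne (h1.1.trans h2.2.symm)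
      rw [if_pos h1, if_neg h2, if_pos (hJ.2 (Or.inl h1)), ← h1.1, ← h1.2]
      split_ifs <;> ring
    · by_cases h2 : i = y ∧ j = x
      · rw [if_neg h1, if_pos h2, if_pos (hJ.2 (Or.inr h2)), ← h2.1, ← h2.2]
        split_ifs <;> ring
      · rw [if_neg h1, if_neg h2, if_neg (fun h => (hJ.1 h).elim h1 h2)]
        ring
  · subst h
    rw [if_neg (lt_irrefl _), if_pos rfl, zero_add, Matrix.single_apply]
    by_cases h1 : i = x ∧ i = y
    · rw [if_pos h1, if_pos (hJ.2 (Or.inl h1)), ← h1.1, ← h1.2]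
      split_ifs <;> ring
    · rw [if_neg h1, if_neg (fun h => (hJ.1 h).elim h1 (fun h => h1 h.symm)), mul_zero]

lemma wedgeMatrix_eq_add_coinSum (A : Matrix (Fin n) (Fin m) ℝ) (p : ℝ) (b : Wedge n m → Bool) :
    wedgeMatrix A p {w | b w = true} = A * Aᵀ + coinSum p (wedgeBasis A) b := by
  rw [wedgeMatrix_eq_sum, ← sum_wedgeBasis, coinSum, ← Finset.sum_add_distrib]
  refine Finset.sum_congr rfl fun w _ => ?_
  rw [coin, sub_smul, one_smul]
  abel

/-- The squared norm of the `k`-th row of `wedgeBasis A w`. -/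
def wedgeRowSq (A : Matrix (Fin n) (Fin m) ℝ) (w : Wedge n m) (k : Fin n) : ℝ :=
  ∑ z, wedgeBasis A w k z ^ 2

lemma wedgeRowSq_nonneg (A : Matrix (Fin n) (Fin m) ℝ) (w : Wedge n m) (k : Fin n) :
    0 ≤ wedgeRowSq A w k := Finset.sum_nonneg fun _ _ => sq_nonneg _

/-- Each row of a wedge matrix has at most one nonzero entry, and distinct rows have disjoint
supports. This is the structure that reduces the matrix moments to scalar ones. -/
lemma wedgeBasis_mul_self (A : Matrix (Fin n) (Fin m) ℝ) (w : Wedge n m) :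
    wedgeBasis A w * wedgeBasis A w = Matrix.diagonal (wedgeRowSq A w) := by
  ext x y
  rw [Matrix.mul_apply]
  rcases eq_or_ne x y with rfl | hxy
  · rw [Matrix.diagonal_apply_eq, wedgeRowSq]
    refine Finset.sum_congr rfl fun z _ => ?_
    rw [sq]
    congr 1
    exact congrFun (congrFun (wedgeBasis_transpose A w) x) z
  · rw [Matrix.diagonal_apply_ne _ hxy]
    refine Finset.sum_eq_zero fun z _ => ?_
    rw [wedgeBasis_apply, wedgeBasis_apply]
    by_cases h1 : w.Joins x z
    · rw [if_neg (fun h2 : w.Joins z y => hxy (h1.symm.right_unique h2)), mul_zero]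
    · rw [if_neg h1, zero_mul]

lemma wedgeBasis_row_eq_zero_or (A : Matrix (Fin n) (Fin m) ℝ) (w : Wedge n m) (k : Fin n) :
    (∀ z, wedgeBasis A w k z = 0) ∨
      ∃ z₀, wedgeBasis A w k z₀ = A k w.1.2.1 * A z₀ w.1.2.1 ∧
        ∀ z, z ≠ z₀ → wedgeBasis A w k z = 0 := by
  by_cases h : ∃ z₀, w.Joins k z₀
  · obtain ⟨z₀, h⟩ := h
    refine Or.inr ⟨z₀, if_pos h, fun z hz => if_neg fun h' => hz (h'.right_unique h)⟩
  · exact Or.inl fun z => if_neg fun h' => h ⟨z, h'⟩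

lemma wedgeRowSq_le {A : Matrix (Fin n) (Fin m) ℝ} {c : ℝ} (hc : 0 ≤ c)
    (hA : ∀ x y l, (A x l * A y l) ^ 2 ≤ c) (w : Wedge n m) (k : Fin n) :
    wedgeRowSq A w k ≤ c := by
  rcases wedgeBasis_row_eq_zero_or A w k with h | ⟨z₀, h1, h2⟩
  · simpa [wedgeRowSq, h] using hc
  · rw [wedgeRowSq, Finset.sum_eq_single z₀ (fun z _ hz => by rw [h2 z hz, sq, zero_mul])
      (by simp), h1]
    exact hA _ _ _

lemma sum_wedgeRowSq (A : Matrix (Fin n) (Fin m) ℝ) (k : Fin n) :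
    ∑ w, wedgeRowSq A w k = ∑ l, A k l ^ 2 * ∑ z, A z l ^ 2 := by
  simp only [wedgeRowSq, Finset.mul_sum]
  rw [Finset.sum_comm, Finset.sum_comm (s := (Finset.univ : Finset (Fin m)))]
  refine Finset.sum_congr rfl fun z _ => ?_
  rw [← sum_wedge_joins k z fun l => A k l ^ 2 * A z l ^ 2]
  refine Finset.sum_congr rfl fun w _ => ?_
  rw [wedgeBasis_apply]
  split_ifs <;> ring

lemma norm_matRow_wedgeBasis_mul_sq_le {r : ℕ} (A : Matrix (Fin n) (Fin m) ℝ) (w : Wedge n m)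
    (k : Fin n) (Y : Matrix (Fin n) (Fin r) ℝ) :
    ‖matRow (wedgeBasis A w * Y) k‖ ^ 2 ≤ twoInfNorm Y ^ 2 * wedgeRowSq A w k := by
  have e : matRow (wedgeBasis A w * Y) k = ∑ z, wedgeBasis A w k z • matRow Y z := by
    ext j
    simp [matRow, Matrix.mul_apply]
  rcases wedgeBasis_row_eq_zero_or A w k with h | ⟨z₀, -, h2⟩
  · rw [e, wedgeRowSq]
    simp [h]
  · rw [e, wedgeRowSq, Finset.sum_eq_single z₀ (fun z _ hz => by rw [h2 z hz, zero_smul])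
      (by simp), Finset.sum_eq_single z₀ (fun z _ hz => by rw [h2 z hz, sq, zero_mul])
      (by simp), norm_smul, mul_pow, Real.norm_eq_abs, sq_abs, mul_comm]
    gcongr
    exact norm_matRow_le_twoInfNorm Y z₀

lemma matRow_coinSum_mul {r : ℕ} (A : Matrix (Fin n) (Fin m) ℝ) (p : ℝ) (b : Wedge n m → Bool)
    (k : Fin n) (Y : Matrix (Fin n) (Fin r) ℝ) :
    matRow (coinSum p (wedgeBasis A) b * Y) k =
      coinSum p (fun w => matRow (wedgeBasis A w * Y) k) b := by
  rw [coinSum, coinSum, Matrix.sum_mul]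
  simp only [Matrix.smul_mul]
  ext j
  simp [matRow, Matrix.sum_apply]

/-- The wedges with end point `k`. -/
def wedgesAt (k : Fin n) : Finset (Wedge n m) := Finset.univ.filter fun w => ∃ z, w.Joins k z

lemma wedgeBasis_eq_zero_of_notMem (A : Matrix (Fin n) (Fin m) ℝ) {w : Wedge n m} {k : Fin n}
    (hw : w ∉ wedgesAt k) (z : Fin n) : wedgeBasis A w k z = 0 := by
  refine if_neg fun h => hw ?_
  simp only [wedgesAt, Finset.mem_filter, Finset.mem_univ, true_and]
  exact ⟨z, h⟩

lemma coordProj_mul_mul_apply (E : Matrix (Fin n) (Fin n) ℝ) (k x y : Fin n) :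
    (coordProj k * E * coordProj k) x y = if x = k ∨ y = k then 0 else E x y := by
  have h : coordProj k = Matrix.diagonal (fun i => if i = k then (0 : ℝ) else 1) := by
    rw [coordProj, ← Matrix.diagonal_one, Matrix.diagonal_sub]
    congr 1
    ext i
    by_cases hi : i = k <;> simp [hi]
  rw [h, Matrix.mul_diagonal, Matrix.diagonal_mul]
  by_cases hx : x = k <;> by_cases hy : y = k <;> simp [hx, hy]

lemma coordProj_wedgeBasis_eq_zero (A : Matrix (Fin n) (Fin m) ℝ) {w : Wedge n m} {k : Fin n}
    (hw : w ∈ wedgesAt k) : coordProj k * wedgeBasis A w * coordProj k = 0 := by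
  simp only [wedgesAt, Finset.mem_filter, Finset.mem_univ, true_and] at hw
  obtain ⟨z, hz⟩ := hw
  ext x y
  rw [coordProj_mul_mul_apply]
  by_cases h : x = k ∨ y = k
  · rw [if_pos h]
    rfl
  · rw [if_neg h]
    refine if_neg fun hxy => ?_
    rcases hz with ⟨h1, h2⟩ | ⟨h1, h2⟩ <;> rcases hxy with ⟨h3, h4⟩ | ⟨h3, h4⟩
    · exact h (Or.inl (h3.symm.trans h1))
    · exact h (Or.inr (h3.symm.trans h1))
    · exact h (Or.inr (h4.symm.trans h2))
    · exact h (Or.inl (h4.symm.trans h2))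

/-- Every entry of a wedge with end point `k` lies in row or column `k`. Hence the leave-one-out
matrix ignores the coins of these wedges, whereas row `k` depends on no other coins
(`matRow_coinSum_piecewise_mul`). -/
lemma coordProj_coinSum_piecewise (A : Matrix (Fin n) (Fin m) ℝ) (p : ℝ) (k : Fin n)
    (b b' : Wedge n m → Bool) :
    coordProj k * coinSum p (wedgeBasis A) ((wedgesAt k).piecewise b' b) * coordProj k =
      coordProj k * coinSum p (wedgeBasis A) b * coordProj k := by
  simp only [coinSum, Finset.mul_sum, Finset.sum_mul, Matrix.mul_smul, Matrix.smul_mul]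
  refine Finset.sum_congr rfl fun w _ => ?_
  by_cases hw : w ∈ wedgesAt k
  · rw [coordProj_wedgeBasis_eq_zero A hw, smul_zero, smul_zero]
  · rw [Finset.piecewise_eq_of_notMem _ _ _ hw]

lemma matRow_coinSum_piecewise_mul {r : ℕ} (A : Matrix (Fin n) (Fin m) ℝ) (p : ℝ) (k : Fin n)
    (b b' : Wedge n m → Bool) (Y : Matrix (Fin n) (Fin r) ℝ) :
    matRow (coinSum p (wedgeBasis A) ((wedgesAt k).piecewise b' b) * Y) k =
      coinSum p (fun w => matRow (wedgeBasis A w * Y) k) b' := by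
  rw [matRow_coinSum_mul]
  refine Finset.sum_congr rfl fun w _ => ?_
  by_cases hw : w ∈ wedgesAt k
  · rw [Finset.piecewise_eq_of_mem _ _ _ hw]
  · have h0 : matRow (wedgeBasis A w * Y) k = 0 := by
      ext j
      simp [matRow, Matrix.mul_apply, wedgeBasis_eq_zero_of_notMem A hw]
    simp only [h0, smul_zero]

end Wedges

/-! ### Recovery on the good event and its probability -/

section Recovery

variable {n m r : ℕ}

open Classical in
/-- A choice of the normalized basis of the perturbed invariant subspace. -/
def graphBasis (U : Matrix (Fin n) (Fin r) ℝ) (v : Fin r → ℝ) (ε : ℝ)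
    (E : Matrix (Fin n) (Fin n) ℝ) : Matrix (Fin n) (Fin r) ℝ :=
  if h : ∃ Y, IsInvariantGraph U v E Y ∧ ‖Y - U‖ ≤ 4 * ε then h.choose else U

lemma graphBasis_spec {U : Matrix (Fin n) (Fin r) ℝ} (hU : Uᵀ * U = 1) {v : Fin r → ℝ} {s : ℝ}
    (hs : 0 < s) (hv : ∀ k, s ≤ v k) {E : Matrix (Fin n) (Fin n) ℝ} (hET : Eᵀ = E) {ε : ℝ}
    (hε : ε ≤ 1 / 8) (hE : ‖E‖ ≤ ε * s) (hrn : r ≤ n) :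
    IsInvariantGraph U v E (graphBasis U v ε E) ∧ ‖graphBasis U v ε E - U‖ ≤ 4 * ε := by
  have h : ∃ Y, IsInvariantGraph U v E Y ∧ ‖Y - U‖ ≤ 4 * ε := by
    have hZ : (U * Matrix.diagonal v * Uᵀ + E)ᵀ = U * Matrix.diagonal v * Uᵀ + E := by
      rw [Matrix.transpose_add, Matrix.transpose_mul, Matrix.transpose_mul,
        Matrix.transpose_transpose, Matrix.diagonal_transpose, hET, Matrix.mul_assoc]
    obtain ⟨Uhat, hUhat⟩ := exists_isTopEigenvectors hZ hrn
    obtain ⟨-, Y, hY, hYn, -⟩ := hUhat.exists_isInvariantGraph hU hs hv hε hE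
    exact ⟨Y, hY, hYn⟩
  rw [graphBasis, dif_pos h]
  exact h.choose_spec

/-- The row hypothesis concerns `graphBasis`, a fixed function of the leave-one-out matrix, rather
than an arbitrary basis; this is what permits conditioning in `bernP_row_le`. -/
lemma recovery_of_good_event {U : Matrix (Fin n) (Fin r) ℝ} (hU : Uᵀ * U = 1) {v : Fin r → ℝ}
    {s : ℝ} (hs : 0 < s) (hv : ∀ k, s ≤ v k) {E : Matrix (Fin n) (Fin n) ℝ} (hET : Eᵀ = E) {ε : ℝ}
    (hε : ε ≤ 1 / 100) (hE : ‖E‖ ≤ ε * s) (hrn : r ≤ n)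
    (hrow : ∀ k, ‖matRow (E * graphBasis U v ε (coordProj k * E * coordProj k)) k‖ ≤
      ε * s * twoInfNorm (graphBasis U v ε (coordProj k * E * coordProj k)))
    {Uhat : Matrix (Fin n) (Fin r) ℝ} {R : Matrix (Fin r) (Fin r) ℝ}
    (hUhat : IsTopEigenvectors (U * Matrix.diagonal v * Uᵀ + E) Uhat)
    (hR : IsProcrustes Uhat U R) :
    ‖Uhat * R - U‖ ≤ 12 * ε ∧ twoInfNorm (Uhat * R - U) ≤ 12 * ε * twoInfNorm U := by
  have hε0 : 0 ≤ ε := by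
    by_contra hneg
    nlinarith [norm_nonneg E]
  have hε8 : ε ≤ 1 / 8 := by linarith
  obtain ⟨hUU, Y, hY, hYn, hYU⟩ := hUhat.exists_isInvariantGraph hU hs hv hε8 hE
  obtain ⟨T, hT, hTeq⟩ := hY.aligned_sub_eq hU hUU hYU hR
  have hD : twoInfNorm (Y - U) ≤ 10 * ε * twoInfNorm U := by
    refine hY.twoInfNorm_sub_le hU hs hv hε hE hYn fun k => ?_
    have hET' : (coordProj k * E * coordProj k)ᵀ = coordProj k * E * coordProj k := by
      have hP : (coordProj k)ᵀ = coordProj k := by simp [coordProj]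
      rw [Matrix.transpose_mul, Matrix.transpose_mul, hP, hET, Matrix.mul_assoc]
    have hspec := graphBasis_spec hU hs hv hET' hε8 ((norm_coordProj_conj_le E k).trans hE) hrn
    exact ⟨_, hspec.1, hspec.2, hrow k⟩
  have hYn1 : ‖Y‖ ≤ 11 / 10 := (norm_le_one_add hU).trans (by linarith)
  have hT' : ‖T‖ ≤ 16 / 100 * ε := by
    refine hT.trans ?_
    calc ‖Y - U‖ ^ 2 ≤ (4 * ε) ^ 2 := by gcongr
      _ = 16 * ε * ε := by ring
      _ ≤ 16 * ε * (1 / 100) := by gcongr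
      _ = _ := by ring
  rw [hTeq]
  constructor
  · have h1 : ‖Y * T‖ ≤ 11 / 10 * (16 / 100 * ε) := (Matrix.l2_opNorm_mul _ _).trans (by gcongr)
    have h2 := norm_add_le (Y - U) (Y * T)
    linarith
  · have hτ := twoInfNorm_nonneg U
    have hτY := twoInfNorm_nonneg Y
    have h1 : twoInfNorm (Y * T) ≤ twoInfNorm Y * (16 / 100 * ε) :=
      twoInfNorm_le (by positivity) fun i => (norm_matRow_mul_le _ _ _).trans
        (mul_le_mul (norm_matRow_le_twoInfNorm _ _) hT' (norm_nonneg _) hτY)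
    have h2 := twoInfNorm_add_le (Y - U) (Y * T)
    have h3 : twoInfNorm Y ≤ twoInfNorm U + twoInfNorm (Y - U) := by
      have h := twoInfNorm_add_le U (Y - U)
      rwa [add_sub_cancel] at h
    have h4 : ε * twoInfNorm U ≤ 1 / 100 * twoInfNorm U := by gcongr
    have h5 : twoInfNorm Y ≤ 11 / 10 * twoInfNorm U := by linarith
    have h6 : twoInfNorm Y * (16 / 100 * ε) ≤ 11 / 10 * twoInfNorm U * (16 / 100 * ε) := by gcongr
    have h7 : 0 ≤ ε * twoInfNorm U := by positivity
    linarith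

/-- The rows of the noise act on the leave-one-out bases as expected. -/
lemma bernP_row_le {A : Matrix (Fin n) (Fin m) ℝ} {p : ℝ} (hp : 0 < p) (hp1 : p ≤ 1)
    {q : ℕ} (hq : 0 < q) {B : ℝ} (hB : 0 < B) (k : Fin n) (hgB : ∑ w, wedgeRowSq A w k ≤ B)
    (hqg : ∀ w, q * wedgeRowSq A w k ≤ p * B)
    (Φ : Matrix (Fin n) (Fin n) ℝ → Matrix (Fin n) (Fin r) ℝ) :
    bernP p {b | Real.sqrt (Real.exp 5 * q * B / p) *
        twoInfNorm (Φ (coordProj k * coinSum p (wedgeBasis A) b * coordProj k)) <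
      ‖matRow (coinSum p (wedgeBasis A) b *
        Φ (coordProj k * coinSum p (wedgeBasis A) b * coordProj k)) k‖} ≤ Real.exp (-q) := by
  -- Only the coins at `k` are resampled, so the matrix `Y` below is constant and row `k` is a sum
  -- of independent vectors.
  refine bernP_le_of_resample hp.le hp1 (wedgesAt k) fun b => ?_
  simp only [Set.mem_ofPred_eq, coordProj_coinSum_piecewise, matRow_coinSum_piecewise_mul]
  set Y := Φ (coordProj k * coinSum p (wedgeBasis A) b * coordProj k)
  have hy := fun w => norm_matRow_wedgeBasis_mul_sq_le A w k Y
  -- The tail bound needs a positive variance proxy; for `Y = 0` the event is empty because its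
  -- inequality is strict.
  rcases (twoInfNorm_nonneg Y).eq_or_lt with h0 | h0
  · have hz : ∀ w, matRow (wedgeBasis A w * Y) k = 0 := fun w => by
      have h := hy w
      rw [← h0] at h
      have h2 : ‖matRow (wedgeBasis A w * Y) k‖ ^ 2 = 0 :=
        le_antisymm (h.trans_eq (by ring)) (sq_nonneg _)
      simpa using h2
    have hemp : {b' : Wedge n m → Bool | Real.sqrt (Real.exp 5 * q * B / p) * twoInfNorm Y <
        ‖coinSum p (fun w => matRow (wedgeBasis A w * Y) k) b'‖} = ∅ := by
      ext b'
      simp [coinSum, hz, ← h0]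
    rw [hemp]
    simp only [bernP, Set.mem_empty_iff_false, if_false, bernE_const]
    positivity
  · have h := bernP_norm_coinSum_le hp hp1 (fun w => matRow (wedgeBasis A w * Y) k) hq
      (B := twoInfNorm Y ^ 2 * B) (by positivity)
      ((Finset.sum_le_sum fun w _ => hy w).trans (by rw [← Finset.mul_sum]; gcongr))
      (fun w => by
        calc (q : ℝ) * ‖matRow (wedgeBasis A w * Y) k‖ ^ 2
            ≤ q * (twoInfNorm Y ^ 2 * wedgeRowSq A w k) := by gcongr; exact hy w
          _ = twoInfNorm Y ^ 2 * (q * wedgeRowSq A w k) := by ring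
          _ ≤ twoInfNorm Y ^ 2 * (p * B) := mul_le_mul_of_nonneg_left (hqg w) (sq_nonneg _)
          _ = _ := by ring)
    have e : Real.sqrt (Real.exp 5 * q * (twoInfNorm Y ^ 2 * B) / p) =
        Real.sqrt (Real.exp 5 * q * B / p) * twoInfNorm Y := by
      rw [show Real.exp 5 * q * (twoInfNorm Y ^ 2 * B) / p =
        Real.exp 5 * q * B / p * twoInfNorm Y ^ 2 by ring,
        Real.sqrt_mul (by positivity), Real.sqrt_sq h0.le]
    rwa [e] at h

/-- Recovery of the left singular subspace in terms of the variance proxy `B`. -/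
lemma bernP_recovery_ge {A : Matrix (Fin n) (Fin m) ℝ} {U : Matrix (Fin n) (Fin r) ℝ}
    (hU : Uᵀ * U = 1) {v : Fin r → ℝ} {s : ℝ} (hs : 0 < s) (hv : ∀ k, s ≤ v k)
    (hA : A * Aᵀ = U * Matrix.diagonal v * Uᵀ) (hrn : r ≤ n) {p : ℝ} (hp : 0 < p) (hp1 : p ≤ 1)
    {q : ℕ} (hq : 0 < q) {B : ℝ} (hB : 0 < B) (hgB : ∀ k, ∑ w, wedgeRowSq A w k ≤ B)
    (hqg : ∀ w k, q * wedgeRowSq A w k ≤ p * B) {ε : ℝ} (hε : ε ≤ 1 / 100)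
    (hεs : Real.sqrt (Real.exp 5 * q * B / p) ≤ ε * s) :
    1 - 2 * (n * Real.exp (-q)) ≤ bernP p {b | ∀ (Uhat : Matrix (Fin n) (Fin r) ℝ)
      (R : Matrix (Fin r) (Fin r) ℝ), IsTopEigenvectors (wedgeMatrix A p {w | b w = true}) Uhat →
        IsProcrustes Uhat U R →
        ‖Uhat * R - U‖ ≤ 12 * ε ∧ twoInfNorm (Uhat * R - U) ≤ 12 * ε * twoInfNorm U} := by
  set t := Real.sqrt (Real.exp 5 * q * B / p) with ht
  set X := coinSum p (wedgeBasis A) with hX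
  set bad₁ : Set (Wedge n m → Bool) := {b | t < ‖X b‖} with hb1
  set bad₂ : Fin n → Set (Wedge n m → Bool) := fun k =>
    {b | t * twoInfNorm (graphBasis U v ε (coordProj k * X b * coordProj k)) <
      ‖matRow (X b * graphBasis U v ε (coordProj k * X b * coordProj k)) k‖} with hb2
  have h1 : bernP p bad₁ ≤ n * Real.exp (-q) :=
    bernP_norm_coinSum_matrix_le hp hp1 (wedgeBasis_transpose A) (wedgeBasis_mul_self A)
      (wedgeRowSq_nonneg A) hq hB hgB hqg
  have h2 : bernP p (⋃ k, bad₂ k) ≤ n * Real.exp (-q) := by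
    refine (bernP_iUnion_le hp.le hp1 bad₂).trans ?_
    refine (Finset.sum_le_sum fun k _ => bernP_row_le hp hp1 hq hB k (hgB k)
      (fun w => hqg w k) (graphBasis U v ε)).trans_eq ?_
    simp
  have h3 := bernP_union_le hp.le hp1 bad₁ (⋃ k, bad₂ k)
  have h4 : bernP p (bad₁ ∪ ⋃ k, bad₂ k)ᶜ ≤ _ := bernP_mono hp.le hp1 (t :=
    {b | ∀ (Uhat : Matrix (Fin n) (Fin r) ℝ)
      (R : Matrix (Fin r) (Fin r) ℝ), IsTopEigenvectors (wedgeMatrix A p {w | b w = true}) Uhat →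
        IsProcrustes Uhat U R →
        ‖Uhat * R - U‖ ≤ 12 * ε ∧ twoInfNorm (Uhat * R - U) ≤ 12 * ε * twoInfNorm U})
    (by
      intro b hb Uhat R hUhat hR
      rw [Set.mem_compl_iff, Set.mem_union, not_or, Set.mem_iUnion, not_exists] at hb
      have hb1' : ‖X b‖ ≤ t := not_lt.1 hb.1
      rw [wedgeMatrix_eq_add_coinSum, hA] at hUhat
      refine recovery_of_good_event hU hs hv (coinSum_transpose p (wedgeBasis_transpose A) b) hε
        (hb1'.trans hεs) hrn (fun k => ?_) hUhat hR
      have hk := hb.2 k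
      simp only [hb2, Set.mem_ofPred_eq, not_lt] at hk
      exact hk.trans (mul_le_mul_of_nonneg_right hεs (twoInfNorm_nonneg _)))
  rw [bernP_compl] at h4
  linarith

end Recovery

/-! ### Variance bounds from incoherence -/

section ThinSVD

variable {n m r : ℕ}

lemma twoInfNorm_pos_of_orthonormal {U : Matrix (Fin n) (Fin r) ℝ} (hr : 0 < r)
    (hU : Uᵀ * U = 1) : 0 < twoInfNorm U := by
  refine (twoInfNorm_nonneg U).lt_of_ne fun h0 => ?_
  have hz : U = 0 := by
    ext i k
    have h1 := norm_matRow_le_twoInfNorm U i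
    rw [← h0] at h1
    have h2 : matRow U i = 0 := norm_le_zero_iff.1 h1
    exact congrArg (fun x : EuclideanSpace ℝ (Fin r) => x k) h2
  have h := congrFun (congrFun hU ⟨0, hr⟩) ⟨0, hr⟩
  rw [hz] at h
  simp at h

lemma IsThinSVD.mul_transpose {A : Matrix (Fin n) (Fin m) ℝ} {U : Matrix (Fin n) (Fin r) ℝ}
    {σ : Fin r → ℝ} {V : Matrix (Fin m) (Fin r) ℝ} (h : IsThinSVD A U σ V) :
    A * Aᵀ = U * Matrix.diagonal (fun k => σ k ^ 2) * Uᵀ := by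
  have e : Matrix.diagonal (fun k => σ k ^ 2) = Matrix.diagonal σ * Matrix.diagonal σ := by
    rw [Matrix.diagonal_mul_diagonal]
    simp only [sq]
  calc A * Aᵀ = U * Matrix.diagonal σ * (Vᵀ * V) * Matrix.diagonal σ * Uᵀ := by
        rw [h.eq_mul]
        simp only [Matrix.transpose_mul, Matrix.transpose_transpose, Matrix.diagonal_transpose,
          Matrix.mul_assoc]
    _ = _ := by rw [h.right_orthonormal, Matrix.mul_one, e, ← Matrix.mul_assoc]

lemma IsThinSVD.norm_diagonal_le {A : Matrix (Fin n) (Fin m) ℝ} {U : Matrix (Fin n) (Fin r) ℝ}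
    {σ : Fin r → ℝ} {V : Matrix (Fin m) (Fin r) ℝ} (h : IsThinSVD A U σ V) (hr : 0 < r) :
    ‖Matrix.diagonal σ‖ ≤ σ ⟨0, hr⟩ :=
  WedgeSampling.norm_diagonal_le (h.pos _).le fun k => by
    rw [abs_of_pos (h.pos k)]
    exact h.antitone (Fin.le_def.2 (Nat.zero_le _))

lemma IsThinSVD.abs_apply_le {A : Matrix (Fin n) (Fin m) ℝ} {U : Matrix (Fin n) (Fin r) ℝ}
    {σ : Fin r → ℝ} {V : Matrix (Fin m) (Fin r) ℝ} (h : IsThinSVD A U σ V) (hr : 0 < r)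
    (x : Fin n) (l : Fin m) :
    |A x l| ≤ σ ⟨0, hr⟩ * twoInfNorm U * twoInfNorm V := by
  have e : A x l = U x ⬝ᵥ (Matrix.diagonal σ *ᵥ V l) := by
    rw [h.eq_mul, Matrix.mul_apply, dotProduct]
    refine Finset.sum_congr rfl fun k _ => ?_
    rw [Matrix.mul_diagonal, Matrix.transpose_apply, Matrix.mulVec_diagonal]
    ring
  have h1 : ‖(WithLp.toLp 2 (Matrix.diagonal σ *ᵥ V l) : EuclideanSpace ℝ (Fin r))‖ ≤
      σ ⟨0, hr⟩ * twoInfNorm V :=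
    (norm_mulVec_le _ _).trans (mul_le_mul (h.norm_diagonal_le hr)
      (norm_matRow_le_twoInfNorm V l) (norm_nonneg _) (h.pos _).le)
  rw [e]
  refine (abs_dotProduct_le _ _).trans ((mul_le_mul (norm_matRow_le_twoInfNorm U x) h1
    (norm_nonneg _) (twoInfNorm_nonneg U)).trans_eq ?_)
  ring

lemma IsThinSVD.sum_row_sq_le {A : Matrix (Fin n) (Fin m) ℝ} {U : Matrix (Fin n) (Fin r) ℝ}
    {σ : Fin r → ℝ} {V : Matrix (Fin m) (Fin r) ℝ} (h : IsThinSVD A U σ V) (hr : 0 < r)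
    (x : Fin n) : ∑ l, A x l ^ 2 ≤ (σ ⟨0, hr⟩ * twoInfNorm U) ^ 2 := by
  rw [← norm_matRow_sq]
  refine pow_le_pow_left₀ (norm_nonneg _) ?_ 2
  have h1 : ‖Matrix.diagonal σ * Vᵀ‖ ≤ σ ⟨0, hr⟩ := by
    refine (Matrix.l2_opNorm_mul _ _).trans ?_
    rw [norm_transpose]
    nlinarith [h.norm_diagonal_le hr, orthogonal_norm_le_one h.right_orthonormal, norm_nonneg V,
      h.pos ⟨0, hr⟩]
  rw [h.eq_mul, Matrix.mul_assoc, mul_comm]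
  exact (norm_matRow_mul_le _ _ _).trans
    (mul_le_mul (norm_matRow_le_twoInfNorm U x) h1 (norm_nonneg _) (twoInfNorm_nonneg U))

lemma IsThinSVD.transpose {A : Matrix (Fin n) (Fin m) ℝ} {U : Matrix (Fin n) (Fin r) ℝ}
    {σ : Fin r → ℝ} {V : Matrix (Fin m) (Fin r) ℝ} (h : IsThinSVD A U σ V) :
    IsThinSVD Aᵀ V σ U where
  left_orthonormal := h.right_orthonormal
  right_orthonormal := h.left_orthonormal
  pos := h.pos
  antitone := h.antitone
  eq_mul := by
    rw [h.eq_mul, Matrix.transpose_mul, Matrix.transpose_mul, Matrix.transpose_transpose,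
      Matrix.diagonal_transpose, Matrix.mul_assoc]

lemma IsThinSVD.wedgeRowSq_le {A : Matrix (Fin n) (Fin m) ℝ} {U : Matrix (Fin n) (Fin r) ℝ}
    {σ : Fin r → ℝ} {V : Matrix (Fin m) (Fin r) ℝ} (h : IsThinSVD A U σ V) (hr : 0 < r)
    {β : ℝ} (hβ : (twoInfNorm U * twoInfNorm V) ^ 2 ≤ β) (w : Wedge n m) (k : Fin n) :
    wedgeRowSq A w k ≤ σ ⟨0, hr⟩ ^ 4 * β ^ 2 := by
  refine WedgeSampling.wedgeRowSq_le (by positivity) (fun x y l => ?_) w k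
  have hx := h.abs_apply_le hr x l
  have hy := h.abs_apply_le hr y l
  have h0 : 0 ≤ σ ⟨0, hr⟩ * twoInfNorm U * twoInfNorm V := (abs_nonneg _).trans hx
  calc (A x l * A y l) ^ 2 = (|A x l| * |A y l|) ^ 2 := by rw [← abs_mul, sq_abs]
    _ ≤ ((σ ⟨0, hr⟩ * twoInfNorm U * twoInfNorm V) *
        (σ ⟨0, hr⟩ * twoInfNorm U * twoInfNorm V)) ^ 2 := by gcongr
    _ = σ ⟨0, hr⟩ ^ 4 * ((twoInfNorm U * twoInfNorm V) ^ 2) ^ 2 := by ring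
    _ ≤ _ := by gcongr

/-- The sum is one row of `A` weighted by squared column norms. Bounding row and column by `σ₁`
times the row norms of `U` and `V` gives one factor `β`; a single wedge has two, so the condition on
the largest summand becomes `q β ≤ p`. -/
lemma IsThinSVD.sum_wedgeRowSq_le {A : Matrix (Fin n) (Fin m) ℝ} {U : Matrix (Fin n) (Fin r) ℝ}
    {σ : Fin r → ℝ} {V : Matrix (Fin m) (Fin r) ℝ} (h : IsThinSVD A U σ V) (hr : 0 < r)
    {β : ℝ} (hβ : (twoInfNorm U * twoInfNorm V) ^ 2 ≤ β) (k : Fin n) :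
    ∑ w, wedgeRowSq A w k ≤ σ ⟨0, hr⟩ ^ 4 * β := by
  rw [sum_wedgeRowSq]
  have hcol := fun l => h.transpose.sum_row_sq_le hr l
  calc ∑ l, A k l ^ 2 * ∑ z, A z l ^ 2
      ≤ ∑ l, A k l ^ 2 * (σ ⟨0, hr⟩ * twoInfNorm V) ^ 2 := by
        gcongr with l _
        exact hcol l
    _ ≤ (σ ⟨0, hr⟩ * twoInfNorm U) ^ 2 * (σ ⟨0, hr⟩ * twoInfNorm V) ^ 2 := by
        rw [← Finset.sum_mul]
        gcongr
        exact h.sum_row_sq_le hr k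
    _ = σ ⟨0, hr⟩ ^ 4 * (twoInfNorm U * twoInfNorm V) ^ 2 := by ring
    _ ≤ _ := by
        have : 0 < σ ⟨0, hr⟩ ^ 4 := pow_pos (h.pos _) 4
        gcongr

end ThinSVD

/-! ### Choice of parameters and the main theorem -/

lemma IsIncoherent.sq_mul_le {n m r : ℕ} {A : Matrix (Fin n) (Fin m) ℝ} {μ₁ μ₂ : ℝ}
    (hA : IsIncoherent A μ₁ μ₂) {U : Matrix (Fin n) (Fin r) ℝ} {σ : Fin r → ℝ}
    {V : Matrix (Fin m) (Fin r) ℝ} (h : IsThinSVD A U σ V) :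
    (twoInfNorm U * twoInfNorm V) ^ 2 ≤ μ₁ * μ₂ * (r : ℝ) ^ 2 / (m * n) := by
  obtain ⟨h1, h2⟩ := hA r U σ V h
  calc (twoInfNorm U * twoInfNorm V) ^ 2 = twoInfNorm U ^ 2 * twoInfNorm V ^ 2 := by ring
    _ ≤ (μ₁ * r / n) * (μ₂ * r / m) :=
      mul_le_mul h1 h2 (sq_nonneg _) ((sq_nonneg _).trans h1)
    _ = _ := by
      rw [div_mul_div_comm]
      congr 1 <;> ring

lemma mul_exp_neg_ceil_le {n : ℕ} (hn : 1 ≤ n) (a : ℝ) :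
    n * Real.exp (-(⌈(a + 1) * Real.log n⌉₊ : ℝ)) ≤ (n : ℝ) ^ (-a) := by
  have hn0 : (0 : ℝ) < n := by exact_mod_cast hn
  calc (n : ℝ) * Real.exp (-(⌈(a + 1) * Real.log n⌉₊ : ℝ))
      ≤ Real.exp (Real.log n) * Real.exp (-((a + 1) * Real.log n)) := by
        rw [Real.exp_log hn0]
        gcongr
        exact Nat.le_ceil _
    _ = (n : ℝ) ^ (-a) := by
        rw [← Real.exp_add, Real.rpow_def_of_pos hn0]
        congr 1
        ring

/-- Since `log n ≥ 1 / 2`, rounding up costs at most `2 log n`, so the excess over `a log n` is at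
most `3 log n`. The lower bound `a₀` on `a` absorbs it, and only here does the dependence on `a₀`
arise. -/
lemma ceil_le_mul_log {n : ℕ} (hn : 2 ≤ n) {a₀ a : ℝ} (ha₀ : 0 < a₀) (ha : a₀ ≤ a) :
    (⌈(a + 1) * Real.log n⌉₊ : ℝ) ≤ (1 + 3 / a₀) * (a * Real.log n) := by
  have hlog : 1 / 2 ≤ Real.log n := by
    have h1 : Real.log 2 ≤ Real.log n := Real.log_le_log (by norm_num) (by exact_mod_cast hn)
    linarith [Real.log_two_gt_d9]
  have h1 := Nat.ceil_lt_add_one (a := (a + 1) * Real.log n) (by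
    have : 0 < a + 1 := by linarith
    positivity)
  have h2 : 3 * Real.log n ≤ 3 / a₀ * (a * Real.log n) := by
    rw [div_mul_eq_mul_div, le_div_iff₀ ha₀]
    nlinarith
  linarith

lemma one_le_condNumber {n m r : ℕ} {A : Matrix (Fin n) (Fin m) ℝ} {U : Matrix (Fin n) (Fin r) ℝ}
    {σ : Fin r → ℝ} {V : Matrix (Fin m) (Fin r) ℝ} (h : IsThinSVD A U σ V) (hr : 0 < r) :
    1 ≤ condNumber hr σ := by
  rw [condNumber, one_le_div (h.pos _)]
  exact h.antitone (Fin.le_def.2 (Nat.zero_le _))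

end WedgeSampling

end

theorem mainTheorem1 (a₀ : ℝ) (ha₀ : 0 < a₀) :
    ∃ c₀ C K : ℝ, 0 < c₀ ∧ 0 < C ∧ 0 < K ∧
      ∀ (n m r : ℕ) (hr : 0 < r)
        (A : Matrix (Fin n) (Fin m) ℝ) (U : Matrix (Fin n) (Fin r) ℝ)
        (σ : Fin r → ℝ) (V : Matrix (Fin m) (Fin r) ℝ) (μ₁ μ₂ a p : ℝ),
        A.rank = r →
        WedgeSampling.IsThinSVD A U σ V →
        WedgeSampling.IsIncoherent A μ₁ μ₂ →
        a₀ ≤ a → 0 < p → p ≤ 1 →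
        c₀ * WedgeSampling.condNumber hr σ ^ 4 * a * μ₁ * μ₂ * (r : ℝ) ^ 2 * Real.log n / (m * n)
          ≤ p →
        ∀ (Ω : Type*) [MeasurableSpace Ω] (P : Measure Ω) [IsProbabilityMeasure P]
          (sampled : WedgeSampling.Wedge n m → Set Ω),
          WedgeSampling.IsWedgeSampling P p sampled →
          1 - K * (n : ℝ) ^ (-a) ≤
            P.real {ω | ∀ (Uhat : Matrix (Fin n) (Fin r) ℝ) (R : Matrix (Fin r) (Fin r) ℝ),
              WedgeSampling.IsTopEigenvectors
                (WedgeSampling.wedgeMatrix A p {w | ω ∈ sampled w}) Uhat →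
              WedgeSampling.IsProcrustes Uhat U R →
              ‖Uhat * R - U‖ ≤ C *
                WedgeSampling.errorRate n m r (WedgeSampling.condNumber hr σ) μ₁ μ₂ a p ∧
              WedgeSampling.twoInfNorm (Uhat * R - U) ≤ C *
                WedgeSampling.errorRate n m r (WedgeSampling.condNumber hr σ) μ₁ μ₂ a p *
                WedgeSampling.twoInfNorm U} := by
  set c₁ : ℝ := Real.exp 5 * (1 + 3 / a₀) with hc₁
  have hc₁0 : 1 ≤ c₁ := by
    have h1 : 1 ≤ Real.exp 5 := Real.one_le_exp (by norm_num)
    have h2 : 0 ≤ 3 / a₀ := by positivity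
    nlinarith
  have hc₁2 : 1 + 3 / a₀ ≤ c₁ := by
    have h1 : 1 ≤ Real.exp 5 := Real.one_le_exp (by norm_num)
    have h2 : 0 ≤ 3 / a₀ := by positivity
    nlinarith
  -- With `ε = √c₁ η`, the factor `10000` yields `ε ≤ 1 / 100`, the `12` is that of
  -- `recovery_of_good_event`, and `2` counts the spectral and the row events.
  refine ⟨10000 * c₁, 12 * Real.sqrt c₁, 2, by positivity, by positivity, by norm_num, ?_⟩
  intro n m r hr A U σ V μ₁ μ₂ a p hrank hsvd hinc ha hp hp1 hpc Ω _ P _ sampled hsampled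
  have hrn : r ≤ n := by
    have := A.rank_le_card_height
    rw [hrank, Fintype.card_fin] at this
    exact this
  have ha0 : 0 < a := ha₀.trans_le ha
  -- For `n = 1` the logarithm vanishes, but the claimed probability bound is negative.
  rcases (show n = 1 ∨ 2 ≤ n by omega) with rfl | hn
  · have h1 : (1 : ℝ) - 2 * ((1 : ℕ) : ℝ) ^ (-a) ≤ 0 := by
      rw [Nat.cast_one, Real.one_rpow]
      norm_num
    exact h1.trans measureReal_nonneg
  set κ := WedgeSampling.condNumber hr σ with hκ
  have hκ1 : 1 ≤ κ := WedgeSampling.one_le_condNumber hsvd hr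
  set σ₁ := σ ⟨0, hr⟩ with hσ₁
  set σr := σ ⟨r - 1, Nat.sub_lt hr Nat.one_pos⟩ with hσr
  have hσ₁0 : 0 < σ₁ := hsvd.pos _
  have hσr0 : 0 < σr := hsvd.pos _
  have hκeq : σ₁ = κ * σr := by
    rw [hκ, WedgeSampling.condNumber, div_mul_cancel₀ _ hσr0.ne']
  set β : ℝ := μ₁ * μ₂ * (r : ℝ) ^ 2 / (m * n) with hβ
  have hβle := hinc.sq_mul_le hsvd
  -- No signs of `μ₁` and `μ₂` are assumed: `β` dominates the squared product of the row norms,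
  -- which are positive by orthonormality.
  have hβ0 : 0 < β := by
    have h1 := WedgeSampling.twoInfNorm_pos_of_orthonormal hr hsvd.left_orthonormal
    have h2 := WedgeSampling.twoInfNorm_pos_of_orthonormal hr hsvd.right_orthonormal
    exact lt_of_lt_of_le (by positivity) hβle
  have hlog : 0 < Real.log n := Real.log_pos (by exact_mod_cast hn)
  set q := ⌈(a + 1) * Real.log n⌉₊ with hq
  have hq0 : 0 < q := Nat.ceil_pos.2 (by positivity)
  have hqle : (q : ℝ) ≤ (1 + 3 / a₀) * (a * Real.log n) :=
    WedgeSampling.ceil_le_mul_log hn ha₀ ha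
  set η := WedgeSampling.errorRate n m r κ μ₁ μ₂ a p with hη
  have hη2 : η ^ 2 = κ ^ 4 * (a * Real.log n) * β / p := by
    have e : κ ^ 4 * a * μ₁ * μ₂ * (r : ℝ) ^ 2 * Real.log n / (m * n * p) =
        κ ^ 4 * (a * Real.log n) * β / p := by
      rw [hβ, mul_div_assoc', div_div]
      congr 1
      ring
    rw [hη, WedgeSampling.errorRate, e, Real.sq_sqrt (by positivity)]
  have hη0 : 0 ≤ η := Real.sqrt_nonneg _
  have hpc' : 10000 * c₁ * (κ ^ 4 * (a * Real.log n) * β) ≤ p := by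
    refine le_of_eq_of_le ?_ hpc
    rw [hβ]
    ring
  have hκ4 : 1 ≤ κ ^ 4 := one_le_pow₀ hκ1
  have hqβ : q * β ≤ p := by
    calc q * β ≤ (1 + 3 / a₀) * (a * Real.log n) * β := by gcongr
      _ ≤ c₁ * (a * Real.log n) * β := by gcongr
      _ = 1 * c₁ * (1 * (a * Real.log n) * β) := by ring
      _ ≤ 10000 * c₁ * (κ ^ 4 * (a * Real.log n) * β) := by gcongr; norm_num
      _ ≤ p := hpc'
  set ε := Real.sqrt c₁ * η with hε
  have hε2 : ε ^ 2 = c₁ * (κ ^ 4 * (a * Real.log n) * β / p) := by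
    rw [hε, mul_pow, Real.sq_sqrt (by linarith), hη2]
  have hε100 : ε ≤ 1 / 100 := by
    refine le_of_sq_le_sq ?_ (by norm_num)
    rw [hε2, ← mul_div_assoc, div_le_iff₀ hp]
    linarith
  have hεs : Real.sqrt (Real.exp 5 * q * (σ₁ ^ 4 * β) / p) ≤ ε * σr ^ 2 := by
    refine Real.sqrt_le_iff.2 ⟨by positivity, ?_⟩
    rw [mul_pow, hε2, hκeq, hc₁]
    calc Real.exp 5 * q * ((κ * σr) ^ 4 * β) / p
        ≤ Real.exp 5 * ((1 + 3 / a₀) * (a * Real.log n)) * ((κ * σr) ^ 4 * β) / p := by gcongr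
      _ = _ := by ring
  have hmain := WedgeSampling.bernP_recovery_ge hsvd.left_orthonormal (v := fun k => σ k ^ 2)
    (s := σr ^ 2) (by positivity)
    (fun k => pow_le_pow_left₀ hσr0.le (hsvd.antitone (Fin.le_def.2 (by
      have := k.2
      simp only
      omega))) 2) hsvd.mul_transpose hrn hp hp1 hq0 (B := σ₁ ^ 4 * β) (by positivity)
    (hsvd.sum_wedgeRowSq_le hr hβle)
    (fun w k => by
      calc (q : ℝ) * WedgeSampling.wedgeRowSq A w k ≤ q * (σ₁ ^ 4 * β ^ 2) := by
            gcongr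
            exact hsvd.wedgeRowSq_le hr hβle w k
        _ = σ₁ ^ 4 * β * (q * β) := by ring
        _ ≤ σ₁ ^ 4 * β * p := by gcongr
        _ = _ := by ring) hε100 hεs
  have hK : 1 - 2 * (n : ℝ) ^ (-a) ≤ 1 - 2 * (n * Real.exp (-(q : ℝ))) := by
    have := WedgeSampling.mul_exp_neg_ceil_le (by omega : 1 ≤ n) a
    linarith
  refine hK.trans (hmain.trans_eq ?_)
  rw [← WedgeSampling.prob_occurs_mem_eq P hp.le hsampled.measurableSet hsampled.indep
    hsampled.prob]
  congr 1
  ext ω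
  simp only [Set.mem_ofPred_eq, WedgeSampling.occurs, decide_eq_true_eq]
  rw [show 12 * ε = 12 * Real.sqrt c₁ * η by rw [hε]; ring]
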